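/- Write $\mathrm{e}(x)=\exp(2\pi i x)$, let $\mathbb{H}$ be the upper half plane, and let $\eta(\tau)=\mathrm{e}(\tau/24)\prod_{n\ge1}(1-\mathrm{e}(n\tau))$ be the Dedekind eta function on $\mathbb{H}$. For $r\in\mathbb{Q}$ put $$\log\eta(\tau)=\log\eta(i)+\int_i^\tau\frac{\eta'(z)}{\eta(z)}\,dz,\qquad \eta^r(\tau)=\exp(r\log\eta(\tau)),$$ where $\log\eta(i)$ is the real logarithm of $\eta(i)>0$. For $h\in\mathbb{Z}$ and an integer $k\ge1$ let $s(h,k)=\sum_{r \bmod k}((r/k))((hr/k))$ be the Dedekind sum, where $((x))=x-\lfloor x\rfloor-\frac12$ for $x\notin\mathbb{Z}$ and $((x))=0$ for $x\in\mathbb{Z}$. For a prime $p$, rational numbers $r_1,r_p$ with $(r_1+pr_p)/24\in\mathbb{Z}$, and rational $k>2$ with $k\in\frac{r_1+r_p}{2}+2\mathbb{Z}$, put $$E^{i\infty}_{k,p}(\tau;r_1,r_p)=1+\sum_{\substack{c>0,\ p\mid c,\ d\in\mathbb{Z}\\ \gcd(c,d)=1}}(c\tau+d)^{-k}\,\mathrm{e}\!\left(-r_1\Big(\tfrac{a+d}{24c}+\tfrac12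 s(-d,c)-\tfrac18\Big)-r_p\Big(\tfrac{a+d}{24c/p}+\tfrac12 s(-d,c/p)-\tfrac18\Big)\right),$$ where the powers $(c\tau+d)^{-k}$ are principal and, for each pair $(c,d)$, $a$ is any integer with $ad\equiv1\pmod c$. (1) If $n_1$ is a rational number with $1/2<n_1\le1$, then for every $\tau\in\mathbb{H}$ and every choice of the integers $a$ the series $E^{i\infty}_{4n_1,2}(\tau;16n_1,-8n_1)$ converges absolutely and $$E^{i\infty}_{4n_1,2}(\tau;16n_1,-8n_1)=\eta^{16n_1}(\tau)\,\eta^{-8n_1}(2\tau).$$ (2) If $n_1$ is a rational number with $2/3<n_1\le1$, then for every $\tau\in\mathbb{H}$ and every choice of the integers $a$ the series $E^{i\infty}_{3n_1,3}(\tau;9n_1,-3n_1)$ converges absolutely and $$E^{i\infty}_{3n_1,3}(\tau;9n_1,-3n_1)=\eta^{9n_1}(\tau)\,\eta^{-3n_1}(3\tau).$$ -/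

import Mathlib

noncomputable section

open Complex UpperHalfPlane

namespace RationalWeight

/-- The sawtooth function: `((x)) = x - ⌊x⌋ - 1/2` if `x` is not an integer, `0` otherwise. -/
def sawtooth (x : ℚ) : ℚ :=
  if Int.fract x = 0 then 0 else x - ⌊x⌋ - 1 / 2

/-- The Dedekind sum `s(h, k) = ∑_{r mod k} ((r/k)) ((hr/k))`, for `k ≥ 1`. -/
def dedekindSum (h : ℤ) (k : ℕ) : ℚ :=
  ∑ r ∈ Finset.range k, sawtooth ((r : ℚ) / k) * sawtooth ((h : ℚ) * r / k)

/-- `e(x) = exp(2πix)`. -/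
def e (x : ℚ) : ℂ := Complex.exp (2 * Real.pi * Complex.I * (x : ℂ))

/-- `log η(τ) = log η(i) + ∫_i^τ η'(z)/η(z) dz` for `τ` in the upper half plane, where `log η(i)` is
the real logarithm of the positive real number `η(i)` and the integral is taken along the
line segment from `i` to `τ`. -/
def logEta (τ : ℂ) : ℂ :=
  (Real.log (ModularForm.eta Complex.I).re : ℂ) +
    ∫ t in (0 : ℝ)..1,
      deriv ModularForm.eta (Complex.I + t * (τ - Complex.I)) /
        ModularForm.eta (Complex.I + t * (τ - Complex.I)) * (τ - Complex.I)

/-- The rational power `η^r(τ) = exp(r log η(τ))`. -/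
def etaPow (r : ℚ) (τ : ℂ) : ℂ := Complex.exp ((r : ℂ) * logEta τ)

/-- The pairs `(c, d)` of coprime integers with `c > 0` and `p ∣ c`. -/
def EisIndex (p : ℕ) : Type :=
  {x : ℕ × ℤ // 0 < x.1 ∧ p ∣ x.1 ∧ Int.gcd (x.1 : ℤ) x.2 = 1}

/-- `a` selects, for each pair `(c, d)`, an integer with `ad ≡ 1 (mod c)`. -/
def IsInverseChoice (p : ℕ) (a : EisIndex p → ℤ) : Prop :=
  ∀ x : EisIndex p, a x * x.1.2 ≡ 1 [ZMOD (x.1.1 : ℤ)]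

/-- The number `(a + d)/(24c) + s(-d, c)/2 - 1/8`. -/
def dedekindPhase (a : ℤ) (c : ℕ) (d : ℤ) : ℚ :=
  ((a : ℚ) + d) / (24 * c) + dedekindSum (-d) c / 2 - 1 / 8

/-- The term of the Eisenstein series at the pair `x = (c, d)`; the power `(cτ + d)^(-k)` is the
principal one, and `c / p` is an exact quotient since `p ∣ c`. -/
def eisTerm (p : ℕ) (k r₁ rₚ : ℚ) (a : EisIndex p → ℤ) (τ : ℍ) (x : EisIndex p) : ℂ :=
  ((x.1.1 : ℂ) * (τ : ℂ) + (x.1.2 : ℂ)) ^ (-(k : ℂ)) *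
    e (-r₁ * dedekindPhase (a x) x.1.1 x.1.2 - rₚ * dedekindPhase (a x) (x.1.1 / p) x.1.2)

/-- The Eisenstein series `E^{i∞}_{k,p}(τ; r₁, rₚ)`, formed with the inverses `a`. -/
def eisInfty (p : ℕ) (k r₁ rₚ : ℚ) (a : EisIndex p → ℤ) (τ : ℍ) : ℂ :=
  1 + ∑' x : EisIndex p, eisTerm p k r₁ rₚ a τ x

end RationalWeight

end

noncomputable section

open Complex UpperHalfPlane

namespace RationalWeight

/-! Write F(τ) = η^r₁(τ) η^rₚ(pτ) (`etaQuot`), with r₁ + p rₚ = 0 and weight k = (r₁ + rₚ)/2 > 2.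
Dedekind's formula `logEta_moebius` shows that the summand of the Eisenstein series at (c, d) is
exactly F(τ)/F(γτ) for any γ in Γ₀(p) with bottom row (c, d) (`eisTerm_eq`). Rational powers and
multipliers are thereby absorbed into values of the single function F. Since r₁ + p rₚ = 0, F has
period 1, so F(γτ) depends only on the bottom row, up to sign.

Let G(τ) be the sum of 1/F(γτ) over all bottom rows (`cosetSum`). Rows come in pairs ±(c, d), so F·G
= 2E. Right multiplication by Γ₀(p) permutes the rows, so G is Γ₀(p)-invariant with no multiplier;
it is holomorphic because |F(τ)/F(γτ)| = |cτ + d|^(-k).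

It remains to bound G at the two cusps of Γ₀(p). At i∞, F·G is bounded and |F| → 1. At 0, F vanishes
to order (p r₁ + rₚ)/24 ≤ 1 in the local parameter q = e(τ/p), while the normalised Eisenstein sum
tends to 0 there, because p ∣ c and coprimality force d ≠ 0. Hence qG → 0, and the removable
singularity theorem makes G bounded (`isBoundedAtImInfty_cosetSum_S`). So G is a modular form of
weight 0, hence constant. Along the imaginary axis F → 1 and E → 1, so G = 2 and E = F.

Dedekind's formula is itself derived from the inversion and translation laws of η by the Euclidean
algorithm on the bottom row, with `dedekindSum_reciprocity` matching the phases at each inversion.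
-/

/-! ### Dedekind sums and their reciprocity law -/

lemma sawtooth_add_intCast (x : ℚ) (n : ℤ) : sawtooth (x + n) = sawtooth x := by
  simp only [sawtooth, Int.fract_add_intCast, Int.floor_add_intCast]
  split_ifs
  · rfl
  · push_cast; ring

lemma sawtooth_neg (x : ℚ) : sawtooth (-x) = -sawtooth x := by
  by_cases h : Int.fract x = 0
  · simp [sawtooth, h, Int.fract_neg_eq_zero.mpr h]
  · have h' : ¬ Int.fract (-x) = 0 := by rwa [Int.fract_neg_eq_zero]
    have := Int.fract_neg h
    simp only [sawtooth, if_neg h, if_neg h']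
    rw [Int.self_sub_floor, Int.self_sub_floor, this]
    ring

lemma dedekindSum_neg (h : ℤ) (k : ℕ) : dedekindSum (-h) k = -dedekindSum h k := by
  simp only [dedekindSum, ← Finset.sum_neg_distrib]
  refine Finset.sum_congr rfl fun r _ ↦ ?_
  rw [← mul_neg, ← sawtooth_neg]
  congr 2
  push_cast; ring

lemma dedekindSum_add_mul {k : ℕ} (hk : k ≠ 0) (h m : ℤ) :
    dedekindSum (h + m * k) k = dedekindSum h k := by
  simp only [dedekindSum]
  refine Finset.sum_congr rfl fun r _ ↦ ?_
  rw [← sawtooth_add_intCast ((h : ℚ) * r / k) (m * r)]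
  congr 2
  have : (k : ℚ) ≠ 0 := by exact_mod_cast hk
  push_cast
  field_simp

lemma sawtooth_natCast_div {k : ℕ} (hk : 0 < k) (n : ℕ) (hn : n % k ≠ 0) :
    sawtooth ((n : ℚ) / k) = ((n % k : ℕ) : ℚ) / k - 1 / 2 := by
  have hk' : (k : ℚ) ≠ 0 := by exact_mod_cast hk.ne'
  have hfl : ⌊((n : ℚ) / k)⌋ = ((n / k : ℕ) : ℤ) := by
    have := Rat.floor_intCast_div_natCast (n : ℤ) k
    rw [Int.cast_natCast] at this
    rw [this, Int.natCast_div]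
  have hdm : (n : ℚ) = k * (n / k : ℕ) + (n % k : ℕ) := by exact_mod_cast (Nat.div_add_mod n k).symm
  have hself : (n : ℚ) / k - ⌊(n : ℚ) / k⌋ = ((n % k : ℕ) : ℚ) / k := by
    rw [hfl, Int.cast_natCast, eq_div_iff hk', sub_mul, div_mul_cancel₀ _ hk']
    linarith
  have hne : ¬ Int.fract ((n : ℚ) / k) = 0 := by
    rw [← Int.self_sub_floor, hself, div_eq_zero_iff]
    push Not
    exact ⟨by exact_mod_cast hn, hk'⟩
  rw [sawtooth, if_neg hne, hself]

/-- Multiplication by a unit permutes the nonzero residues mod `k`. -/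
lemma sum_mul_mod {h k : ℕ} (hk : 0 < k) (hc : h.Coprime k) (g : ℕ → ℚ) :
    ∑ r ∈ Finset.Ico 1 k, g (h * r % k) = ∑ r ∈ Finset.Ico 1 k, g r := by
  have hmaps : ∀ r ∈ Finset.Ico 1 k, h * r % k ∈ Finset.Ico 1 k := by
    intro r hr
    rw [Finset.mem_Ico] at hr ⊢
    refine ⟨Nat.one_le_iff_ne_zero.mpr fun h0 ↦ ?_, Nat.mod_lt _ hk⟩
    have : k ∣ r := hc.symm.dvd_of_dvd_mul_left (Nat.dvd_of_mod_eq_zero h0)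
    exact absurd (Nat.le_of_dvd (by omega) this) (by omega)
  have hinj : Set.InjOn (fun r ↦ h * r % k) (Finset.Ico 1 k : Set ℕ) := by
    intro r hr s hs hrs
    simp only [Finset.coe_Ico, Set.mem_Ico] at hr hs
    have : r ≡ s [MOD k] := Nat.ModEq.cancel_left_of_coprime (by simpa using hc.symm) hrs
    exact Nat.ModEq.eq_of_lt_of_lt this hr.2 hs.2
  exact Finset.sum_nbij (fun r ↦ h * r % k) hmaps hinj
    (Finset.surjOn_of_injOn_of_card_le _ hmaps hinj le_rfl) fun _ _ ↦ rfl

/-- Coprimality keeps `hr/k` non-integral for `0 < r < k`, so only `r = 0` meets the exceptional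
branch of the sawtooth. -/
lemma dedekindSum_eq_sum_mod {h k : ℕ} (hk : 0 < k) (hc : h.Coprime k) :
    dedekindSum h k = ∑ r ∈ Finset.Ico 1 k,
      ((r : ℚ) / k - 1 / 2) * (((h * r % k : ℕ) : ℚ) / k - 1 / 2) := by
  rw [dedekindSum, Finset.range_eq_Ico, Finset.sum_eq_sum_Ico_succ_bot hk]
  simp only [sawtooth, Nat.cast_zero, zero_div, Int.fract_zero, if_true, zero_mul, zero_add]
  refine Finset.sum_congr rfl fun r hr ↦ ?_
  rw [Finset.mem_Ico] at hr
  have h1 := sawtooth_natCast_div hk r (by rw [Nat.mod_eq_of_lt hr.2]; omega)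
  have h2 := sawtooth_natCast_div hk (h * r) (fun h0 ↦ by
    have : k ∣ r := hc.symm.dvd_of_dvd_mul_left (Nat.dvd_of_mod_eq_zero h0)
    exact absurd (Nat.le_of_dvd (by omega) this) (by omega))
  rw [Nat.mod_eq_of_lt hr.2] at h1
  rw [← sawtooth, ← sawtooth, h1, ← h2]
  congr 2
  push_cast; ring

lemma sum_Ico_one_id (k : ℕ) (hk : 0 < k) : ∑ r ∈ Finset.Ico 1 k, (r : ℚ) = k * (k - 1) / 2 := by
  induction k, hk using Nat.le_induction with
  | base => simp
  | succ n hn ih => rw [Finset.sum_Ico_succ_top hn, ih]; push_cast; ring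

lemma sum_Ico_one_sq (k : ℕ) (hk : 0 < k) :
    ∑ r ∈ Finset.Ico 1 k, (r : ℚ) ^ 2 = k * (k - 1) * (2 * k - 1) / 6 := by
  induction k, hk using Nat.le_induction with
  | base => simp
  | succ n hn ih => rw [Finset.sum_Ico_succ_top hn, ih]; push_cast; ring

/-- Counting lattice points below the line of slope `h / k` by rows and by columns. -/
lemma sum_div_mul_div_add_one {h k : ℕ} (hh : 0 < h) (hk : 0 < k) (hc : h.Coprime k) :
    ∑ r ∈ Finset.Ico 1 k, ((h * r / k : ℕ) : ℚ) * ((h * r / k : ℕ) + 1) =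
      ∑ s ∈ Finset.Ico 1 h, 2 * (s : ℚ) * (k - 1 - (k * s / h : ℕ)) := by
  -- Uses n(n + 1) = 2(1 + ... + n) with n = ⌊hr/k⌋: each lattice point of height s below the line
  -- is weighted by 2s.
  have hrow : ∀ r ∈ Finset.Ico 1 k, ((h * r / k : ℕ) : ℚ) * ((h * r / k : ℕ) + 1) =
      ∑ s ∈ Finset.Ico 1 h, if k * s ≤ h * r then 2 * (s : ℚ) else 0 := by
    intro r hr
    rw [Finset.mem_Ico] at hr
    have hlt : h * r / k < h := by
      rw [Nat.div_lt_iff_lt_mul hk]; exact Nat.mul_lt_mul_of_pos_left hr.2 hh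
    rw [← Finset.sum_filter]
    have : (Finset.Ico 1 h).filter (fun s ↦ k * s ≤ h * r) = Finset.Ico 1 (h * r / k + 1) := by
      ext s
      simp only [Finset.mem_filter, Finset.mem_Ico, Nat.lt_succ_iff, Nat.le_div_iff_mul_le hk,
        mul_comm s k]
      constructor
      · rintro ⟨⟨h1, _⟩, h2⟩; exact ⟨h1, h2⟩
      · rintro ⟨h1, h2⟩
        refine ⟨⟨h1, lt_of_le_of_lt ?_ hlt⟩, h2⟩
        rwa [Nat.le_div_iff_mul_le hk, mul_comm]
    rw [this, ← Finset.mul_sum, sum_Ico_one_id _ (Nat.succ_pos _)]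
    push_cast; ring
  rw [Finset.sum_congr rfl hrow, Finset.sum_comm]
  refine Finset.sum_congr rfl fun s hs ↦ ?_
  rw [Finset.mem_Ico] at hs
  have hlt : k * s / h < k := by
    rw [Nat.div_lt_iff_lt_mul hh]; exact Nat.mul_lt_mul_of_pos_left hs.2 hk
  rw [← Finset.sum_filter]
  have : (Finset.Ico 1 k).filter (fun r ↦ k * s ≤ h * r) = Finset.Ico (k * s / h + 1) k := by
    ext r
    simp only [Finset.mem_filter, Finset.mem_Ico, Nat.succ_le_iff, Nat.div_lt_iff_lt_mul hh,
      mul_comm r h]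
    constructor
    · rintro ⟨⟨h1, h2⟩, h3⟩
      refine ⟨lt_of_le_of_ne h3 fun heq ↦ ?_, h2⟩
      -- A lattice point on the line itself would force `h ∣ s`, impossible for 0 < s < h.
      have : h ∣ s := hc.dvd_of_dvd_mul_left ⟨r, heq⟩
      exact absurd (Nat.le_of_dvd (by omega) this) (by omega)
    · rintro ⟨h1, h2⟩
      refine ⟨⟨?_, h2⟩, h1.le⟩
      rcases Nat.eq_zero_or_pos r with rfl | h0
      · simp at h1
      · exact h0
  rw [this, Finset.sum_const, Nat.card_Ico, nsmul_eq_mul, Nat.cast_sub hlt]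
  push_cast; ring

/-- The reciprocity law for Dedekind sums. -/
theorem dedekindSum_reciprocity {h k : ℕ} (hh : 0 < h) (hk : 0 < k) (hc : h.Coprime k) :
    dedekindSum h k + dedekindSum k h =
      -1 / 4 + ((h : ℚ) / k + k / h + 1 / (h * k)) / 12 := by
  have hk' : (k : ℚ) ≠ 0 := by exact_mod_cast hk.ne'
  have hh' : (h : ℚ) ≠ 0 := by exact_mod_cast hh.ne'
  -- Reduces each Dedekind sum to the single unknown Σ r⌊hr/k⌋.
  have key : ∀ {h k : ℕ}, 0 < k → h.Coprime k → (k : ℚ) ^ 2 * dedekindSum h k =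
      h * (k * (k - 1) * (2 * k - 1) / 6) - k * (∑ r ∈ Finset.Ico 1 k, (r : ℚ) * (h * r / k : ℕ))
        - k ^ 2 * (k - 1) / 4 := by
    intro h k hk hc
    have hk' : (k : ℚ) ≠ 0 := by exact_mod_cast hk.ne'
    have hm : ∀ r, ((h * r % k : ℕ) : ℚ) = h * r - k * (h * r / k : ℕ) := fun r ↦ by
      have : (h * r : ℚ) = k * (h * r / k : ℕ) + (h * r % k : ℕ) := by
        exact_mod_cast (Nat.div_add_mod (h * r) k).symm
      linarith
    have e1 := sum_mul_mod hk hc (fun r ↦ (r : ℚ))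
    rw [sum_Ico_one_id k hk] at e1
    rw [dedekindSum_eq_sum_mod hk hc, ← sum_Ico_one_sq k hk]
    have : ∀ r ∈ Finset.Ico 1 k,
        ((r : ℚ) / k - 1 / 2) * (((h * r % k : ℕ) : ℚ) / k - 1 / 2) =
        (1 / k ^ 2) * (h * (r : ℚ) ^ 2 - k * (r * (h * r / k : ℕ))) - 1 / (2 * k) * r
          - 1 / (2 * k) * ((h * r % k : ℕ) : ℚ) + 1 / 4 := by
      intro r _
      rw [hm]; field_simp; ring
    rw [Finset.sum_congr rfl this, Finset.sum_add_distrib, Finset.sum_sub_distrib,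
      Finset.sum_sub_distrib, ← Finset.mul_sum, ← Finset.mul_sum, ← Finset.mul_sum, e1,
      sum_Ico_one_id k hk, Finset.sum_sub_distrib, ← Finset.mul_sum, ← Finset.mul_sum,
      Finset.sum_const, Nat.card_Ico, nsmul_eq_mul, Nat.cast_sub hk]
    field_simp
    push_cast
    ring
  have k1 := key hk hc
  have k2 := key hh hc.symm
  have hm : ∀ r, ((h * r % k : ℕ) : ℚ) = h * r - k * (h * r / k : ℕ) := fun r ↦ by
    have : (h * r : ℚ) = k * (h * r / k : ℕ) + (h * r % k : ℕ) := by
      exact_mod_cast (Nat.div_add_mod (h * r) k).symm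
    linarith
  -- The first and second moments of the remainders (`e1`, `e2`) determine Σ⌊hr/k⌋ and relate
  -- Σ⌊hr/k⌋² to Σ r⌊hr/k⌋. The lattice count `e3` then passes to Σ s⌊ks/h⌋, the unknown of the
  -- other Dedekind sum.
  have e1 := sum_mul_mod hk hc (fun r ↦ (r : ℚ))
  have e2 := sum_mul_mod hk hc (fun r ↦ (r : ℚ) ^ 2)
  have e3 := sum_div_mul_div_add_one hh hk hc
  simp only [hm] at e1 e2
  rw [Finset.sum_sub_distrib, ← Finset.mul_sum, ← Finset.mul_sum, sum_Ico_one_id k hk] at e1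
  have e2' : ∑ r ∈ Finset.Ico 1 k, ((h : ℚ) * r - k * (h * r / k : ℕ)) ^ 2 =
      h ^ 2 * ∑ r ∈ Finset.Ico 1 k, (r : ℚ) ^ 2
        - 2 * h * k * ∑ r ∈ Finset.Ico 1 k, (r : ℚ) * (h * r / k : ℕ)
        + k ^ 2 * ∑ r ∈ Finset.Ico 1 k, ((h * r / k : ℕ) : ℚ) ^ 2 := by
    rw [Finset.mul_sum, Finset.mul_sum, Finset.mul_sum, ← Finset.sum_sub_distrib,
      ← Finset.sum_add_distrib]
    exact Finset.sum_congr rfl fun r _ ↦ by ring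
  have e3l : ∑ r ∈ Finset.Ico 1 k, ((h * r / k : ℕ) : ℚ) * ((h * r / k : ℕ) + 1) =
      ∑ r ∈ Finset.Ico 1 k, ((h * r / k : ℕ) : ℚ) ^ 2 +
        ∑ r ∈ Finset.Ico 1 k, ((h * r / k : ℕ) : ℚ) := by
    rw [← Finset.sum_add_distrib]
    exact Finset.sum_congr rfl fun r _ ↦ by ring
  have e3r : ∑ s ∈ Finset.Ico 1 h, 2 * (s : ℚ) * (k - 1 - (k * s / h : ℕ)) =
      2 * (k - 1) * ∑ s ∈ Finset.Ico 1 h, (s : ℚ)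
        - 2 * ∑ s ∈ Finset.Ico 1 h, (s : ℚ) * (k * s / h : ℕ) := by
    rw [Finset.mul_sum, Finset.mul_sum, ← Finset.sum_sub_distrib]
    exact Finset.sum_congr rfl fun r _ ↦ by ring
  rw [e2', sum_Ico_one_sq k hk] at e2
  rw [e3l, e3r, sum_Ico_one_id h hh] at e3
  have hk2 : (12 : ℚ) * h ^ 2 * k ^ 2 ≠ 0 := by positivity
  apply mul_left_cancel₀ hk2
  have hr : 12 * (h : ℚ) ^ 2 * k ^ 2 *
      (-1 / 4 + ((h : ℚ) / k + k / h + 1 / (h * k)) / 12) =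
      -3 * h ^ 2 * k ^ 2 + h ^ 3 * k + h * k ^ 3 + h * k := by field_simp; ring
  rw [hr]
  linear_combination 12 * h ^ 2 * k1 + 12 * k ^ 2 * k2 + 6 * h * e2 - 6 * h * k ^ 2 * e3 - 6 * h * k * e1

/-! ### The branch `log η`, inversion and translation -/

open ModularForm

lemma I_mem_upperHalfPlaneSet : (Complex.I : ℂ) ∈ upperHalfPlaneSet := by
  simp [upperHalfPlaneSet]

lemma convex_upperHalfPlaneSet : Convex ℝ upperHalfPlaneSet := convex_halfSpace_im_gt 0

lemma differentiableOn_eta : DifferentiableOn ℂ η upperHalfPlaneSet := fun _ hz ↦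
  (differentiableAt_eta_of_mem_upperHalfPlaneSet hz).differentiableWithinAt

/-- The half plane is convex and η has no zeros, so η'/η has a holomorphic primitive there;
integrating along segments inside the half plane recovers it. -/
lemma exists_logEta_eq_primitive : ∃ g : ℂ → ℂ,
    (∀ z ∈ upperHalfPlaneSet, HasDerivAt g (deriv η z / η z) z) ∧
    ∀ z ∈ upperHalfPlaneSet,
      logEta z = (Real.log (η Complex.I).re : ℂ) + (g z - g Complex.I) := by
  have hd : DifferentiableOn ℂ (fun z ↦ deriv η z / η z) upperHalfPlaneSet :=
    (differentiableOn_eta.deriv isOpen_upperHalfPlaneSet).div differentiableOn_eta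
      fun z hz ↦ eta_ne_zero hz
  obtain ⟨g, hg⟩ := convex_upperHalfPlaneSet.exists_forall_hasDerivWithinAt hd
  have hg' : ∀ z ∈ upperHalfPlaneSet, HasDerivAt g (deriv η z / η z) z := fun z hz ↦
    (hg z hz).hasDerivAt (isOpen_upperHalfPlaneSet.mem_nhds hz)
  refine ⟨g, hg', fun z hz ↦ ?_⟩
  have hseg : ∀ t ∈ Set.uIcc (0 : ℝ) 1, Complex.I + t * (z - Complex.I) ∈ upperHalfPlaneSet := by
    intro t ht
    rw [Set.uIcc_of_le zero_le_one] at ht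
    have := convex_upperHalfPlaneSet.add_smul_sub_mem I_mem_upperHalfPlaneSet hz ht
    simpa using this
  rw [logEta, intervalIntegral.integral_eq_sub_of_hasDerivAt
    (f := fun t : ℝ ↦ g (Complex.I + t * (z - Complex.I)))]
  · simp
  · intro t ht
    have h1 : HasDerivAt (fun t : ℝ ↦ Complex.I + t * (z - Complex.I)) (z - Complex.I) t := by
      simpa using ((ofRealCLM.hasDerivAt (x := t)).mul_const (z - Complex.I)).const_add Complex.I
    exact (hg' _ (hseg t ht)).comp t h1
  · apply ContinuousOn.intervalIntegrable
    refine ContinuousOn.mul ?_ continuousOn_const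
    exact hd.continuousOn.comp (by fun_prop) hseg

lemma hasDerivAt_logEta {z : ℂ} (hz : z ∈ upperHalfPlaneSet) :
    HasDerivAt logEta (deriv η z / η z) z := by
  obtain ⟨g, hg, hlog⟩ := exists_logEta_eq_primitive
  refine (((hg z hz).sub_const (g Complex.I)).const_add
    (Real.log (η Complex.I).re : ℂ)).congr_of_eventuallyEq ?_
  filter_upwards [isOpen_upperHalfPlaneSet.mem_nhds hz] with w hw using hlog w hw

lemma continuousOn_logEta : ContinuousOn logEta upperHalfPlaneSet := fun _ hz ↦
  (hasDerivAt_logEta hz).continuousAt.continuousWithinAt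

lemma logEta_I : logEta Complex.I = (Real.log (η Complex.I).re : ℂ) := by
  simp [logEta]

/-- The eta function is positive on the imaginary axis. -/
lemma exists_pos_eta_I_mul {y : ℝ} (hy : 0 < y) :
    ∃ r : ℝ, 0 < r ∧ η (Complex.I * y) = r := by
  set q : ℝ := Real.exp (-(2 * Real.pi * y)) with hq
  have hq1 : q < 1 := by rw [hq, Real.exp_lt_one_iff]; have := Real.pi_pos; simp; positivity
  have hq0 : 0 < q := Real.exp_pos _
  have hzmem : Complex.I * y ∈ upperHalfPlaneSet := by simpa [upperHalfPlaneSet] using hy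
  have hQ : ∀ n : ℕ, 1 - eta_q n (Complex.I * y) = ((1 - q ^ (n + 1) : ℝ) : ℂ) := by
    intro n
    rw [eta_q_eq_pow, hq]
    push_cast
    congr 3
    linear_combination (2 * Real.pi * y : ℂ) * I_sq
  have hQ24 : Function.Periodic.qParam 24 (Complex.I * y) =
      (Real.exp (-(2 * Real.pi * y) / 24) : ℝ) := by
    rw [Function.Periodic.qParam]
    push_cast
    congr 1
    linear_combination (2 * Real.pi * y / 24 : ℂ) * I_sq
  have hmul : Multipliable fun n : ℕ ↦ (1 - q ^ (n + 1) : ℝ) := by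
    simp_rw [sub_eq_add_neg]
    apply multipliable_one_add_of_summable
    simpa [abs_of_pos hq0] using
      (summable_nat_add_iff 1).mpr (summable_geometric_of_lt_one hq0.le hq1)
  have hprod : ∏' n, (1 - eta_q n (Complex.I * y)) = ((∏' n : ℕ, (1 - q ^ (n + 1)) : ℝ) : ℂ) := by
    simp_rw [hQ]
    exact (hmul.map_tprod Complex.ofRealHom Complex.continuous_ofReal).symm
  have hne := eta_tprod_ne_zero hzmem
  -- The limit of positive partial products is only known to be nonnegative; the nonvanishing `hne`
  -- makes it positive.
  have hnonneg : 0 ≤ ∏' n : ℕ, (1 - q ^ (n + 1)) :=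
    ge_of_tendsto' hmul.hasProd fun s ↦ Finset.prod_nonneg fun n _ ↦ by
      have := pow_le_one₀ (n := n + 1) hq0.le hq1.le
      linarith
  rw [hprod] at hne
  refine ⟨Real.exp (-(2 * Real.pi * y) / 24) * ∏' n : ℕ, (1 - q ^ (n + 1)),
    mul_pos (Real.exp_pos _) (lt_of_le_of_ne hnonneg fun h ↦ hne (by rw [← h]; simp)), ?_⟩
  rw [ModularForm.eta, hprod, hQ24]
  push_cast
  rfl

/-- The function exp(-log η)·η has zero derivative, and it equals 1 at i because η(i) > 0. -/
lemma exp_logEta {z : ℂ} (hz : z ∈ upperHalfPlaneSet) : Complex.exp (logEta z) = η z := by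
  have hderiv : ∀ w ∈ upperHalfPlaneSet,
      HasDerivAt (fun w ↦ Complex.exp (-logEta w) * η w) 0 w := by
    intro w hw
    have h1 := (hasDerivAt_logEta hw).neg.cexp.mul
      (differentiableAt_eta_of_mem_upperHalfPlaneSet hw).hasDerivAt
    have h0 := eta_ne_zero hw
    rwa [mul_assoc, neg_mul, div_mul_cancel₀ _ h0, mul_neg, neg_add_cancel] at h1
  have hconst := convex_upperHalfPlaneSet.is_const_of_fderivWithin_eq_zero (𝕜 := ℂ)
    (fun w hw ↦ (hderiv w hw).differentiableAt.differentiableWithinAt)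
    (fun w hw ↦ by
      rw [fderivWithin_of_isOpen isOpen_upperHalfPlaneSet hw]
      ext
      simp [(hderiv w hw).deriv]) hz I_mem_upperHalfPlaneSet
  obtain ⟨r, hr, hη⟩ := exists_pos_eta_I_mul one_pos
  simp only [ofReal_one, mul_one] at hη
  rw [logEta_I, hη, ofReal_re, ← ofReal_neg, ← ofReal_exp, Real.exp_neg, Real.exp_log hr,
    ← ofReal_mul, inv_mul_cancel₀ hr.ne', Complex.exp_neg] at hconst
  have := Complex.exp_ne_zero (logEta z)
  field_simp at hconst
  simpa using hconst.symm

/-- The values of `D` lie in 2πiℤ, so their imaginary parts form an interval containing 0 and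
missing ±π. This lifts identities for η to identities for `logEta`, given agreement at one point. -/
lemma eq_zero_of_exp_eq_one {X : Type*} [TopologicalSpace X] {s : Set X} (hs : IsPreconnected s)
    {D : X → ℂ} (hD : ContinuousOn D s) (hexp : ∀ x ∈ s, Complex.exp (D x) = 1) {x₀ : X}
    (hx₀ : x₀ ∈ s) (h₀ : D x₀ = 0) {x : X} (hx : x ∈ s) : D x = 0 := by
  obtain ⟨n, hn⟩ := Complex.exp_eq_one_iff.mp (hexp x hx)
  have him : (D x).im = n * (2 * Real.pi) := by rw [hn]; simp
  have hpi := Real.pi_pos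
  have hcont : ContinuousOn (fun x ↦ (D x).im) s := Complex.continuous_im.comp_continuousOn hD
  have hconn := (hs.image _ hcont).ordConnected
  have habs : ∀ v : ℝ, v ∈ (fun x ↦ (D x).im) '' s → v ≠ Real.pi ∧ v ≠ -Real.pi := by
    rintro v ⟨y, hy, rfl⟩
    obtain ⟨m, hm⟩ := Complex.exp_eq_one_iff.mp (hexp y hy)
    have hm' : (D y).im = m * (2 * Real.pi) := by rw [hm]; simp
    simp only [hm']
    constructor
    · intro h
      have : (2 * m - 1 : ℝ) = 0 := by
        apply mul_right_cancel₀ hpi.ne'; linarith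
      have : (2 * m - 1 : ℤ) = 0 := by exact_mod_cast this
      omega
    · intro h
      have : (2 * m + 1 : ℝ) = 0 := by
        apply mul_right_cancel₀ hpi.ne'; linarith
      have : (2 * m + 1 : ℤ) = 0 := by exact_mod_cast this
      omega
  have h0mem : (0 : ℝ) ∈ (fun x ↦ (D x).im) '' s := ⟨x₀, hx₀, by simp [h₀]⟩
  have hxmem : (n * (2 * Real.pi) : ℝ) ∈ (fun x ↦ (D x).im) '' s := ⟨x, hx, him⟩
  rcases lt_trichotomy n 0 with hneg | rfl | hpos
  · have : (n : ℝ) ≤ -1 := by exact_mod_cast (by omega : n ≤ -1)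
    exact absurd rfl (habs _ (hconn.out hxmem h0mem ⟨by nlinarith, by linarith⟩)).2
  · simpa using hn
  · have : (1 : ℝ) ≤ n := by exact_mod_cast (by omega : 1 ≤ n)
    exact absurd rfl (habs _ (hconn.out h0mem hxmem ⟨by linarith, by nlinarith⟩)).1

lemma neg_inv_mem {z : ℂ} (hz : z ∈ upperHalfPlaneSet) : -1 / z ∈ upperHalfPlaneSet := by
  have := UpperHalfPlane.im_inv_neg_coe_pos ⟨z, hz⟩
  rwa [inv_neg, ← one_div, ← neg_div] at this

lemma mem_slitPlane_of_mem {z : ℂ} (hz : z ∈ upperHalfPlaneSet) : z ∈ slitPlane :=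
  Or.inr (ne_of_gt hz)

/-- The exponentiated identity is the inversion law of η. The branch is settled at the fixed point
i, where the correction term vanishes. -/
lemma logEta_neg_inv {z : ℂ} (hz : z ∈ upperHalfPlaneSet) :
    logEta (-1 / z) = logEta z + (Complex.log z / 2 - Real.pi * Complex.I / 4) := by
  rw [← sub_eq_zero]
  refine eq_zero_of_exp_eq_one (s := upperHalfPlaneSet)
    (D := fun z ↦ logEta (-1 / z) - (logEta z + (Complex.log z / 2 - Real.pi * Complex.I / 4)))
    convex_upperHalfPlaneSet.isPreconnected ?_ ?_ I_mem_upperHalfPlaneSet ?_ hz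
  · refine ContinuousOn.sub (continuousOn_logEta.comp ?_ fun w hw ↦ neg_inv_mem hw)
      (continuousOn_logEta.add ((ContinuousOn.div_const ?_ _).sub continuousOn_const))
    · exact continuousOn_const.div continuousOn_id fun w hw h ↦ by
        rw [h] at hw; simp [upperHalfPlaneSet] at hw
    · exact fun w hw ↦ (continuousAt_clog (mem_slitPlane_of_mem hw)).continuousWithinAt
  · intro w hw
    have hw0 : w ≠ 0 := slitPlane_ne_zero (mem_slitPlane_of_mem hw)
    have h1 := eta_comp_eq_csqrt_I_inv hw
    simp only [Function.comp_apply, Pi.smul_apply, Pi.mul_apply, smul_eq_mul] at h1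
    rw [_root_.sqrt_eq_exp I_ne_zero, _root_.sqrt_eq_exp hw0, log_I] at h1
    rw [Complex.exp_sub, exp_logEta (neg_inv_mem hw), h1, Complex.exp_add, exp_logEta hw,
      Complex.exp_sub, div_eq_one_iff_eq]
    · rw [show (Real.pi / 2 * Complex.I / 2 : ℂ) = Real.pi * Complex.I / 4 by ring]
      field_simp
    · exact mul_ne_zero (eta_ne_zero hw) (div_ne_zero (Complex.exp_ne_zero _) (Complex.exp_ne_zero _))
  · have : (-1 / Complex.I : ℂ) = Complex.I := by rw [div_I]; simp
    rw [this, log_I]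
    ring

lemma add_one_mem {z : ℂ} (hz : z ∈ upperHalfPlaneSet) : z + 1 ∈ upperHalfPlaneSet := by
  simpa [upperHalfPlaneSet] using hz

lemma eta_add_one (z : ℂ) : η (z + 1) = Complex.exp (Real.pi * Complex.I / 12) * η z := by
  have h : ∀ n, eta_q n (z + 1) = eta_q n z := fun n ↦ by
    rw [eta_q_eq_pow, eta_q_eq_pow, mul_add, mul_one, Complex.exp_periodic]
  simp only [ModularForm.eta, h]
  rw [← mul_assoc]
  congr 1
  rw [Function.Periodic.qParam, Function.Periodic.qParam, ← Complex.exp_add]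
  congr 1
  push_cast
  ring

/-- The value of the period is forced by the fixed point `exp(πi/3)` of `τ ↦ -1/τ + 1`. -/
lemma logEta_add_one {z : ℂ} (hz : z ∈ upperHalfPlaneSet) :
    logEta (z + 1) = logEta z + Real.pi * Complex.I / 12 := by
  set ρ : ℂ := Complex.exp ((Real.pi / 3 : ℝ) * Complex.I) with hρ
  have hρmem : ρ ∈ upperHalfPlaneSet := by
    have : 0 < Real.sin (Real.pi / 3) := Real.sin_pos_of_pos_of_lt_pi (by positivity)
      (by linarith [Real.pi_pos])
    simpa only [upperHalfPlaneSet, hρ, Set.mem_ofPred_eq, exp_ofReal_mul_I_im] using this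
  have hlog : Complex.log ρ = (Real.pi / 3 : ℝ) * Complex.I :=
    Complex.log_exp (by simp; linarith [Real.pi_pos]) (by simp; linarith [Real.pi_pos])
  have hfix : -1 / ρ + 1 = ρ := by
    have hinv : -1 / ρ = -Complex.exp ((-(Real.pi / 3) : ℝ) * Complex.I) := by
      rw [hρ, neg_div, one_div, ← Complex.exp_neg]; push_cast; ring_nf
    rw [hinv, hρ]
    apply Complex.ext
    · simp only [add_re, neg_re, exp_ofReal_mul_I_re, one_re, Real.cos_neg, Real.cos_pi_div_three]
      norm_num
    · simp only [add_im, neg_im, exp_ofReal_mul_I_im, one_im, Real.sin_neg]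
      ring
  -- The base point is -1/ρ, which translation by 1 sends to ρ. Inversion gives log η(ρ) - log
  -- η(-1/ρ) = πi/4 - πi/6 = πi/12.
  have hSρ := logEta_neg_inv hρmem
  rw [← sub_eq_zero]
  refine eq_zero_of_exp_eq_one (s := upperHalfPlaneSet)
    (D := fun z ↦ logEta (z + 1) - (logEta z + Real.pi * Complex.I / 12))
    convex_upperHalfPlaneSet.isPreconnected ?_ ?_ (neg_inv_mem hρmem) ?_ hz
  · exact (continuousOn_logEta.comp (by fun_prop) fun w hw ↦ add_one_mem hw).sub
      (continuousOn_logEta.add continuousOn_const)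
  · intro w hw
    rw [Complex.exp_sub, exp_logEta (add_one_mem hw), eta_add_one, Complex.exp_add, exp_logEta hw,
      div_eq_one_iff_eq (mul_ne_zero (eta_ne_zero hw) (Complex.exp_ne_zero _)), mul_comm]
  · rw [hfix, hSρ, hlog]
    push_cast
    ring

lemma logEta_add_intCast {z : ℂ} (hz : z ∈ upperHalfPlaneSet) (m : ℤ) :
    logEta (z + m) = logEta z + m * (Real.pi * Complex.I / 12) := by
  have hmem : ∀ m : ℤ, z + m ∈ upperHalfPlaneSet := fun m ↦ by
    simpa [upperHalfPlaneSet] using hz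
  induction m with
  | zero => simp
  | succ n ih =>
    have := logEta_add_one (hmem n)
    push_cast at ih this ⊢
    rw [← add_assoc, this, ih]; ring
  | pred n ih =>
    have := logEta_add_one (hmem (-n - 1))
    push_cast at ih this ⊢
    rw [show z + (-(n : ℂ) - 1) + 1 = z + -n by ring, ih] at this
    linear_combination -this

/-- Positivity of η on the imaginary axis puts this imaginary part in 2πℤ; by continuity it keeps
its value 0 at i. -/
lemma logEta_I_mul_im {y : ℝ} (hy : 0 < y) : (logEta (Complex.I * y)).im = 0 := by
  have hmem : ∀ t ∈ Set.Ioi (0 : ℝ), Complex.I * t ∈ upperHalfPlaneSet := fun t ht ↦ by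
    simpa [upperHalfPlaneSet] using ht
  have h := eq_zero_of_exp_eq_one (s := Set.Ioi (0 : ℝ))
    (D := fun t ↦ ((logEta (Complex.I * t)).im : ℂ) * Complex.I) isPreconnected_Ioi ?_ ?_
    (Set.mem_Ioi.mpr one_pos) ?_ (Set.mem_Ioi.mpr hy)
  · simpa using h
  · refine ContinuousOn.mul ?_ continuousOn_const
    refine Complex.continuous_ofReal.comp_continuousOn (Complex.continuous_im.comp_continuousOn ?_)
    exact continuousOn_logEta.comp (by fun_prop) hmem
  · intro t ht
    obtain ⟨r, hr, hη⟩ := exists_pos_eta_I_mul ht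
    have h1 := exp_logEta (hmem t ht)
    have hn : ‖Complex.exp (logEta (Complex.I * t))‖ = r := by
      rw [h1, hη, norm_real, Real.norm_of_nonneg hr.le]
    rw [← re_add_im (logEta _), Complex.exp_add, hη, ← ofReal_exp] at h1
    rw [Complex.norm_exp] at hn
    rw [hn] at h1
    exact mul_left_cancel₀ (ofReal_ne_zero.mpr hr.ne') (by rw [h1, mul_one])
  · simp only [ofReal_one, mul_one, logEta_I, ofReal_im, ofReal_zero, zero_mul]

/-! ### Dedekind's transformation formula -/

lemma arg_mem_Ioo_of_mem {z : ℂ} (hz : z ∈ upperHalfPlaneSet) : z.arg ∈ Set.Ioo 0 Real.pi := by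
  have him : 0 < z.im := hz
  refine ⟨lt_of_le_of_ne (arg_nonneg_iff.mpr him.le) fun h ↦ ?_,
    arg_lt_pi_iff.mpr (Or.inr him.ne')⟩
  exact him.ne' (arg_eq_zero_iff.mp h.symm).2

/-- Both sides agree modulo 2πi. All three arguments lie in (0, π), so the imaginary parts differ by
more than -2π and less than π, which leaves only the multiple 0. This controls the branch when an
inversion is composed with another transformation. -/
lemma log_add_log_eq {u v w : ℂ} (hu : u ∈ upperHalfPlaneSet) (hv : v ∈ upperHalfPlaneSet)
    (hw : w ∈ upperHalfPlaneSet) (h : u * v = -w) :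
    Complex.log u + Complex.log v = Complex.log w + Real.pi * Complex.I := by
  have hne : ∀ {x}, x ∈ upperHalfPlaneSet → x ≠ 0 := fun hx ↦
    slitPlane_ne_zero (mem_slitPlane_of_mem hx)
  have hexp : Complex.exp (Complex.log u + Complex.log v) =
      Complex.exp (Complex.log w + Real.pi * Complex.I) := by
    rw [Complex.exp_add, Complex.exp_add, exp_log (hne hu), exp_log (hne hv), exp_log (hne hw),
      exp_pi_mul_I, h, mul_neg_one]
  obtain ⟨n, hn⟩ := Complex.exp_eq_exp_iff_exists_int.mp hexp
  have him := congrArg Complex.im hn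
  simp only [add_im, log_im, mul_im, ofReal_re, Complex.I_im, ofReal_im, Complex.I_re, mul_one, mul_zero, zero_mul,
    add_zero, intCast_re, intCast_im, mul_re, re_ofNat, im_ofNat, sub_zero, sub_self] at him
  have h1 := arg_mem_Ioo_of_mem hu
  have h2 := arg_mem_Ioo_of_mem hv
  have h3 := arg_mem_Ioo_of_mem hw
  have hpi := Real.pi_pos
  have hn1 : (-1 : ℝ) < n := by
    by_contra! hc
    nlinarith [h1.1, h2.1, h3.2]
  have hn2 : (n : ℝ) < 1 := by
    by_contra! hc
    nlinarith [h1.2, h2.2, h3.1]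
  have : n = 0 := by
    have a1 : -1 < n := by exact_mod_cast hn1
    have a2 : n < 1 := by exact_mod_cast hn2
    omega
  simpa [this] using hn

lemma dedekindPhase_add_mul {c : ℕ} (hc : 0 < c) (a d m : ℤ) :
    dedekindPhase a c (d + m * c) = dedekindPhase a c d + m / 24 := by
  have hc' : (c : ℚ) ≠ 0 := by exact_mod_cast hc.ne'
  rw [dedekindPhase, dedekindPhase, show -(d + m * (c : ℤ)) = -d + (-m) * c by ring,
    dedekindSum_add_mul hc.ne']
  push_cast
  field_simp
  ring

/-- The form of the reciprocity law governing the multiplier of `log η`. -/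
lemma dedekindPhase_eq_add {c d : ℕ} (hc : 0 < c) (hd : 0 < d) {a b : ℤ}
    (hdet : a * d - b * c = 1) :
    dedekindPhase a c d = dedekindPhase b d (-c) + 1 / 8 := by
  have hcop : d.Coprime c := by
    rw [← Nat.isCoprime_iff_coprime]
    exact ⟨a, -b, by linarith⟩
  have hrec := dedekindSum_reciprocity hd hc hcop
  have hc' : (c : ℚ) ≠ 0 := by exact_mod_cast hc.ne'
  have hd' : (d : ℚ) ≠ 0 := by exact_mod_cast hd.ne'
  have hdet' : (a : ℚ) * d - b * c = 1 := by exact_mod_cast hdet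
  rw [dedekindPhase, dedekindPhase, neg_neg, dedekindSum_neg]
  have : ((a : ℚ) + d) / (24 * c) - (b + -c) / (24 * d) =
      ((d : ℚ) / c + c / d + 1 / (d * c)) / 24 := by
    field_simp
    linear_combination hdet'
  push_cast
  linear_combination this - hrec / 2

lemma linear_mem {c : ℕ} (hc : 0 < c) (d : ℤ) {z : ℂ} (hz : z ∈ upperHalfPlaneSet) :
    (c : ℂ) * z + d ∈ upperHalfPlaneSet := by
  have hz' : 0 < z.im := hz
  have hc' : (0 : ℝ) < c := by exact_mod_cast hc
  have : 0 < (c : ℝ) * z.im := mul_pos hc' hz'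
  simpa [upperHalfPlaneSet] using this

/-- Dedekind's transformation formula for `log η`. -/
theorem logEta_moebius {c : ℕ} (hc : 0 < c) {a b d : ℤ} (hdet : a * d - b * c = 1)
    {z : ℂ} (hz : z ∈ upperHalfPlaneSet) :
    logEta ((a * z + b) / (c * z + d)) = logEta z + Complex.log (c * z + d) / 2 +
      2 * Real.pi * Complex.I * (dedekindPhase a c d : ℂ) := by
  -- The Euclidean algorithm on the bottom row: translations reduce `d` modulo `c`, and an inversion
  -- exchanges the two entries.
  induction c using Nat.strong_induction_on generalizing a b d z with
  | _ c ih =>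
  have hcZ : (0 : ℤ) < c := by exact_mod_cast hc
  suffices key : ∀ (d₀ : ℕ) (b : ℤ) (z : ℂ), z ∈ upperHalfPlaneSet → d₀ < c →
      a * d₀ - b * c = 1 →
      logEta ((a * z + b) / (c * z + (d₀ : ℤ))) = logEta z + Complex.log (c * z + (d₀ : ℤ)) / 2 +
        2 * Real.pi * Complex.I * (dedekindPhase a c d₀ : ℂ) by
    have hmod := Int.emod_add_mul_ediv d c
    have hnn := Int.emod_nonneg d hcZ.ne'
    have hlt := Int.emod_lt_of_pos d hcZ
    obtain ⟨d₀, hd₀⟩ := Int.eq_ofNat_of_zero_le hnn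
    set m := d / (c : ℤ) with hm
    have hd : d = d₀ + m * c := by rw [← hd₀, mul_comm m]; exact hmod.symm
    have hmem : z + m ∈ upperHalfPlaneSet := by simpa [upperHalfPlaneSet] using hz
    have h1 := key d₀ (b - a * m) (z + m) hmem (by omega) (by rw [hd] at hdet; linarith)
    rw [hd, dedekindPhase_add_mul hc]
    have e1 : (c : ℂ) * (z + m) + (d₀ : ℤ) = c * z + ((d₀ + m * c : ℤ) : ℂ) := by push_cast; ring
    have e2 : (a : ℂ) * (z + m) + ((b - a * m : ℤ) : ℂ) = a * z + b := by push_cast; ring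
    rw [e1, e2, logEta_add_intCast hz] at h1
    rw [h1]
    push_cast
    ring
  intro d₀ b z hz hlt hdet
  have hz0 : z ≠ 0 := slitPlane_ne_zero (mem_slitPlane_of_mem hz)
  rcases Nat.eq_zero_or_pos d₀ with rfl | hd₀
  -- With d₀ = 0 the determinant forces c = 1 and b = -1, so the map is z ↦ -1/z + a.
  · have hc1 : (c : ℤ) = 1 := by
      have : (c : ℤ) ∣ 1 := ⟨-b, by push_cast at hdet; linarith⟩
      exact Int.eq_one_of_dvd_one hcZ.le this
    have hc1' : c = 1 := by exact_mod_cast hc1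
    subst hc1'
    have hb : b = -1 := by push_cast at hdet; linarith
    subst hb
    have e1 : ((a : ℂ) * z + ((-1 : ℤ) : ℂ)) / (((1 : ℕ) : ℂ) * z + (((0 : ℕ) : ℤ) : ℂ)) =
        -1 / z + a := by
      push_cast
      rw [one_mul, add_zero]
      field_simp
      ring
    rw [e1, logEta_add_intCast (neg_inv_mem hz), logEta_neg_inv hz]
    have : dedekindPhase a 1 (0 : ℕ) = a / 24 - 1 / 8 := by
      simp [dedekindPhase, dedekindSum, sawtooth]
    rw [this]
    push_cast
    rw [one_mul, add_zero]
    ring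
  · have hw := neg_inv_mem hz
    -- The matrix (a, b; c, d₀) acts at z as (b, -a; d₀, -c) acts at -1/z, and d₀ < c.
    have h1 := ih d₀ hlt hd₀ (a := b) (b := -a) (d := -c) (by linarith) hw
    have e1 : ((b : ℂ) * (-1 / z) + ((-a : ℤ) : ℂ)) / (d₀ * (-1 / z) + ((-c : ℤ) : ℂ)) =
        (a * z + b) / (c * z + (d₀ : ℤ)) := by
      have n1 := slitPlane_ne_zero (mem_slitPlane_of_mem (linear_mem hc d₀ hz))
      have n2 := slitPlane_ne_zero (mem_slitPlane_of_mem (linear_mem hd₀ (-c) hw))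
      rw [div_eq_div_iff n2 n1]
      push_cast
      field_simp
      ring
    have hlog := log_add_log_eq hz (linear_mem hd₀ (-c) hw) (linear_mem hc d₀ hz) (by
      push_cast; field_simp; ring)
    rw [e1, logEta_neg_inv hz] at h1
    rw [h1, dedekindPhase_eq_add hc hd₀ hdet]
    push_cast at hlog ⊢
    linear_combination hlog / 2

/-! ### Eta quotients and the terms of the Eisenstein series -/

open scoped MatrixGroups

/-- The eta quotient `η^r₁(z) η^rₚ(pz)`. -/
def etaQuot (p : ℕ) (r₁ rₚ : ℚ) (z : ℂ) : ℂ := etaPow r₁ z * etaPow rₚ (p * z)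

variable {p : ℕ} {r₁ rₚ : ℚ}

lemma etaQuot_eq_exp (z : ℂ) :
    etaQuot p r₁ rₚ z = Complex.exp (r₁ * logEta z + rₚ * logEta (p * z)) := by
  rw [etaQuot, etaPow, etaPow, Complex.exp_add]

lemma etaQuot_ne_zero (z : ℂ) : etaQuot p r₁ rₚ z ≠ 0 := by
  rw [etaQuot_eq_exp]; exact Complex.exp_ne_zero _

lemma natCast_mul_mem (hp : 0 < p) {z : ℂ} (hz : z ∈ upperHalfPlaneSet) :
    (p : ℂ) * z ∈ upperHalfPlaneSet := by
  simpa using linear_mem hp 0 hz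

lemma differentiableOn_etaQuot (hp : 0 < p) :
    DifferentiableOn ℂ (etaQuot p r₁ rₚ) upperHalfPlaneSet := by
  have h : DifferentiableOn ℂ logEta upperHalfPlaneSet := fun z hz ↦
    (hasDerivAt_logEta hz).differentiableAt.differentiableWithinAt
  have h2 : DifferentiableOn ℂ (fun z ↦ logEta (p * z)) upperHalfPlaneSet :=
    h.comp (by fun_prop) fun z hz ↦ natCast_mul_mem hp hz
  exact (((h.const_mul _).add (h2.const_mul _)).cexp).congr fun z _ ↦ etaQuot_eq_exp z

/-- The two logarithms together shift by m(r₁ + p rₚ)πi/12 = 0, so not even a root of unity appears.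
-/
lemma etaQuot_add_intCast (hp : 0 < p) (h0 : r₁ + p * rₚ = 0) {z : ℂ} (hz : z ∈ upperHalfPlaneSet)
    (m : ℤ) : etaQuot p r₁ rₚ (z + m) = etaQuot p r₁ rₚ z := by
  have h2 := logEta_add_intCast (natCast_mul_mem hp hz) (p * m)
  have h0' : (r₁ : ℂ) + p * rₚ = 0 := by exact_mod_cast h0
  push_cast at h2
  rw [etaQuot_eq_exp, etaQuot_eq_exp, logEta_add_intCast hz, mul_add (p : ℂ), h2]
  congr 1
  linear_combination (m * (Real.pi * Complex.I / 12)) * h0'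

lemma coe_SL_smul (γ : SL(2, ℤ)) (τ : ℍ) : ((γ • τ : ℍ) : ℂ) =
    ((γ 0 0 : ℤ) * τ + (γ 0 1 : ℤ)) / ((γ 1 0 : ℤ) * τ + (γ 1 1 : ℤ)) := by
  rw [UpperHalfPlane.specialLinearGroup_apply]; simp

/-- `η^r₁(z) η^rₚ(pz)` at `γτ` depends only on the bottom row of `γ`, up to sign. -/
lemma etaQuot_smul_eq_of_row (hp : 0 < p) (h0 : r₁ + p * rₚ = 0) {γ γ' : SL(2, ℤ)}
    (h : γ 1 0 * γ' 1 1 = γ 1 1 * γ' 1 0) (τ : ℍ) :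
    etaQuot p r₁ rₚ (γ • τ : ℍ) = etaQuot p r₁ rₚ (γ' • τ : ℍ) := by
  -- Proportional bottom rows make γγ'⁻¹ upper triangular, so it acts as a translation.
  obtain ⟨n, hn⟩ := ModularGroup.exists_eq_T_zpow_of_c_eq_zero (g := γ * γ'⁻¹) (by
    simp [Matrix.SpecialLinearGroup.coe_inv, Matrix.adjugate_fin_two, Matrix.mul_apply, h])
  have h1 := hn (γ' • τ)
  rw [← mul_smul, inv_mul_cancel_right] at h1
  rw [h1, ModularGroup.coe_T_zpow_smul_eq, etaQuot_add_intCast hp h0 (γ' • τ).2]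

lemma norm_cpow_ratCast (z : ℂ) (k : ℚ) : ‖z ^ (-(k : ℂ))‖ = ‖z‖ ^ (-(k : ℝ)) := by
  rw [← norm_cpow_real]; push_cast; rfl

lemma norm_e (x : ℚ) : ‖e x‖ = 1 := by
  rw [e, show (2 * Real.pi * Complex.I * (x : ℂ)) = ((2 * Real.pi * x : ℝ) : ℂ) * Complex.I by
    push_cast; ring, norm_exp_ofReal_mul_I]

lemma norm_eisTerm (k : ℚ) (a : EisIndex p → ℤ) (τ : ℍ) (x : EisIndex p) :
    ‖eisTerm p k r₁ rₚ a τ x‖ = ‖(x.1.1 : ℂ) * τ + x.1.2‖ ^ (-(k : ℝ)) := by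
  rw [eisTerm, norm_mul, norm_e, mul_one, norm_cpow_ratCast]

/-- The summand of the Eisenstein series is a quotient of values of the eta quotient. -/
lemma eisTerm_eq (hp : 0 < p) {a : EisIndex p → ℤ} (x : EisIndex p) {γ : SL(2, ℤ)}
    (h00 : γ 0 0 = a x) (h10 : γ 1 0 = x.1.1) (h11 : γ 1 1 = x.1.2) (τ : ℍ) :
    eisTerm p ((r₁ + rₚ) / 2) r₁ rₚ a τ x =
      etaQuot p r₁ rₚ τ * (etaQuot p r₁ rₚ (γ • τ : ℍ))⁻¹ := by
  obtain ⟨⟨c, d⟩, hx⟩ := x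
  obtain ⟨c', hcc⟩ := hx.2.1
  have hc : 0 < c := hx.1
  simp only at hcc h10 h11
  subst hcc
  set A := a ⟨(p * c', d), hx⟩ with hA
  have hc' : 0 < c' := Nat.pos_of_mul_pos_left hc
  have hdet : A * d - γ 0 1 * (p * c' : ℕ) = 1 := by
    have := γ.det_coe
    rw [Matrix.det_fin_two, h00, h10, h11] at this
    exact this
  have hτ : (τ : ℂ) ∈ upperHalfPlaneSet := τ.2
  have h1 := logEta_moebius hc hdet hτ
  -- With c = pc', the point p·γτ is the image of pτ under (A, pB; c', d), B being the upper right
  -- entry of γ. The linear factor is cτ + d again, so the two half logarithms add up to the weight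
  -- (r₁ + rₚ)/2.
  have h2 := logEta_moebius hc' (a := A) (b := γ 0 1 * p) (d := d)
    (by push_cast at hdet; linarith) (natCast_mul_mem hp hτ)
  have e1 : ((γ • τ : ℍ) : ℂ) = (A * τ + (γ 0 1 : ℤ)) / ((p * c' : ℕ) * τ + d) := by
    rw [coe_SL_smul, h00, h10, h11]; norm_cast
  have e2 : (A * (p * (τ : ℂ)) + ((γ 0 1 * p : ℤ) : ℂ)) / (c' * (p * (τ : ℂ)) + d) =
      p * ((γ • τ : ℍ) : ℂ) := by
    rw [e1]; push_cast; ring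
  have e3 : (c' : ℂ) * (p * (τ : ℂ)) + d = (p * c' : ℕ) * τ + d := by push_cast; ring
  rw [e2, e3] at h2
  rw [← e1] at h1
  have hne : ((p * c' : ℕ) : ℂ) * τ + d ≠ 0 :=
    slitPlane_ne_zero (mem_slitPlane_of_mem (linear_mem hc d hτ))
  unfold eisTerm
  rw [etaQuot_eq_exp, etaQuot_eq_exp, h1, h2, cpow_def_of_ne_zero hne, e,
    ← Complex.exp_add, ← Complex.exp_neg, ← Complex.exp_add, ← hA]
  congr 1
  simp only [Nat.mul_div_cancel_left c' hp]
  push_cast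
  ring

/-! ### Sums over bottom rows -/

/-- The coprime pairs `(c, d)` with `p ∣ c`: the bottom rows of the elements of `Γ₀(p)`. -/
def bottomRows (p : ℕ) : Set (Fin 2 → ℤ) := {v | IsCoprime (v 0) (v 1) ∧ (p : ℤ) ∣ v 0}

/-- A matrix in `SL(2, ℤ)` with prescribed bottom row. -/
def rowLift (v : bottomRows p) : SL(2, ℤ) := (v.2.1.exists_SL2_row 1).choose

lemma rowLift_zero (v : bottomRows p) : rowLift v 1 0 = v.1 0 :=
  (v.2.1.exists_SL2_row 1).choose_spec.1

lemma rowLift_one (v : bottomRows p) : rowLift v 1 1 = v.1 1 :=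
  (v.2.1.exists_SL2_row 1).choose_spec.2

variable (r₁ rₚ) in
/-- The inverse of the eta quotient at `γτ`, where `γ` has bottom row `v`. -/
def cosetTerm (v : bottomRows p) (τ : ℍ) : ℂ := (etaQuot p r₁ rₚ (rowLift v • τ : ℍ))⁻¹

lemma cosetTerm_eq (hp : 0 < p) (h0 : r₁ + p * rₚ = 0) (v : bottomRows p) {γ : SL(2, ℤ)}
    (h : v.1 0 * γ 1 1 = v.1 1 * γ 1 0) (τ : ℍ) :
    cosetTerm r₁ rₚ v τ = (etaQuot p r₁ rₚ (γ • τ : ℍ))⁻¹ := by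
  rw [cosetTerm, etaQuot_smul_eq_of_row hp h0 (γ' := γ) (by rw [rowLift_zero, rowLift_one, h])]

/-- The bottom row `±(c, d)`, where the index `none` stands for `(0, 1)`. -/
def signedRow (p : ℕ) (x : Option (EisIndex p) × ℤˣ) : bottomRows p :=
  match x with
  | (none, u) => ⟨![0, u], isCoprime_zero_left.mpr u.isUnit, dvd_zero _⟩
  | (some x, u) => ⟨![u * x.1.1, u * x.1.2], by
      obtain ⟨⟨c, d⟩, hc, hpc, hcd⟩ := x
      have hcop : IsCoprime (c : ℤ) d := Int.isCoprime_iff_gcd_eq_one.mpr hcd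
      refine ⟨?_, ?_⟩
      · rcases Int.units_eq_one_or u with rfl | rfl
        · simpa using hcop
        · simpa using hcop.neg_neg
      · exact dvd_mul_of_dvd_right (by exact_mod_cast hpc) _⟩

lemma signedRow_bijective (p : ℕ) : Function.Bijective (signedRow p) := by
  constructor
  · rintro ⟨_ | ⟨⟨c, d⟩, hc, hpc, hcd⟩, u⟩ ⟨_ | ⟨⟨c', d'⟩, hc', hpc', hcd'⟩, u'⟩ h
    · have h1 := congrFun (congrArg Subtype.val h) 1
      simp only [signedRow, Matrix.cons_val_one, Matrix.cons_val_fin_one] at h1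
      rw [Units.ext h1]
    · have h1 := congrFun (congrArg Subtype.val h) 0
      rcases Int.units_eq_one_or u' with rfl | rfl <;> simp [signedRow] at h1 hc' <;> omega
    · have h1 := congrFun (congrArg Subtype.val h) 0
      rcases Int.units_eq_one_or u with rfl | rfl <;> simp [signedRow] at h1 hc <;> omega
    · have h1 := congrFun (congrArg Subtype.val h) 0
      have h2 := congrFun (congrArg Subtype.val h) 1
      have key : u = u' ∧ c = c' ∧ d = d' := by
        rcases Int.units_eq_one_or u with rfl | rfl <;>
        rcases Int.units_eq_one_or u' with rfl | rfl <;>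
        simp [signedRow] at h1 h2 hc hc' ⊢ <;> omega
      obtain ⟨rfl, rfl, rfl⟩ := key
      rfl
  · rintro ⟨v, hcop, hpv⟩
    rcases lt_trichotomy (v 0) 0 with h | h | h
    · refine ⟨(some ⟨((v 0).natAbs, -v 1), by simpa using h.ne, Int.natCast_dvd.mp hpv, ?_⟩, -1), ?_⟩
      · simpa [Int.gcd, Int.natAbs_abs] using Int.isCoprime_iff_gcd_eq_one.mp hcop
      · apply Subtype.ext
        funext i
        fin_cases i
        · simp [signedRow, abs_of_neg h]
        · simp [signedRow]
    · rw [h, isCoprime_zero_left] at hcop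
      refine ⟨(none, hcop.unit), ?_⟩
      apply Subtype.ext
      funext i
      fin_cases i
      · simp [signedRow, h]
      · simp [signedRow]
    · refine ⟨(some ⟨((v 0).natAbs, v 1), by simpa using h.ne', Int.natCast_dvd.mp hpv, ?_⟩, 1), ?_⟩
      · simpa [Int.gcd, Int.natAbs_abs] using Int.isCoprime_iff_gcd_eq_one.mp hcop
      · apply Subtype.ext
        funext i
        fin_cases i
        · simp [signedRow, abs_of_pos h]
        · simp [signedRow]

/-- Summing an even function over the bottom rows. -/
lemma tsum_bottomRows {f : bottomRows p → ℂ} (hf : Summable f)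
    (heven : ∀ x u, f (signedRow p (x, u)) = f (signedRow p (x, 1))) :
    ∑' v, f v = 2 * (f (signedRow p (none, 1)) + ∑' x, f (signedRow p (some x, 1))) := by
  classical
  let E := Equiv.ofBijective _ (signedRow_bijective p)
  have hs : Summable fun x ↦ f (signedRow p x) := E.summable_iff.mpr hf
  have hs1 : Summable fun x ↦ f (signedRow p (x, 1)) :=
    hs.comp_injective (i := fun x ↦ (x, (1 : ℤˣ))) fun _ _ h ↦ (Prod.mk.inj h).1
  rw [← E.tsum_eq f]
  change ∑' x, f (signedRow p x) = _
  rw [hs.tsum_prod]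
  simp_rw [heven, tsum_fintype, Finset.sum_const]
  rw [Finset.card_univ, Fintype.card_units_int]
  simp_rw [nsmul_eq_mul]
  rw [tsum_mul_left, hs1.tsum_eq_add_tsum_ite none, ← (Option.some_injective _).tsum_eq
    (f := fun x ↦ if x = none then 0 else f (signedRow p (x, 1)))]
  · simp
  · rintro (_ | x) hx
    · simp at hx
    · exact ⟨x, rfl⟩

lemma exists_SL_of_index {a : EisIndex p → ℤ} (ha : IsInverseChoice p a) (x : EisIndex p) :
    ∃ γ : SL(2, ℤ), γ 0 0 = a x ∧ γ 1 0 = x.1.1 ∧ γ 1 1 = x.1.2 := by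
  obtain ⟨b, hb⟩ := (ha x).symm.dvd
  refine ⟨⟨!![a x, b; (x.1.1 : ℤ), x.1.2], ?_⟩, ?_⟩
  · rw [Matrix.det_fin_two_of]; linarith
  · simp

lemma cosetTerm_signedRow (hp : 0 < p) (h0 : r₁ + p * rₚ = 0) (x : Option (EisIndex p)) (u : ℤˣ)
    (τ : ℍ) : cosetTerm r₁ rₚ (signedRow p (x, u)) τ = cosetTerm r₁ rₚ (signedRow p (x, 1)) τ := by
  refine cosetTerm_eq hp h0 _ ?_ τ
  rw [rowLift_zero, rowLift_one]
  cases x with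
  | none => simp [signedRow]
  | some x => simp [signedRow]; ring

lemma cosetTerm_none (hp : 0 < p) (h0 : r₁ + p * rₚ = 0) (u : ℤˣ) (τ : ℍ) :
    etaQuot p r₁ rₚ τ * cosetTerm r₁ rₚ (signedRow p (none, u)) τ = 1 := by
  rw [cosetTerm_eq hp h0 _ (γ := 1) (by simp [signedRow]), one_smul,
    mul_inv_cancel₀ (etaQuot_ne_zero _)]

lemma cosetTerm_some (hp : 0 < p) (h0 : r₁ + p * rₚ = 0) {a : EisIndex p → ℤ}
    (ha : IsInverseChoice p a) (x : EisIndex p) (τ : ℍ) :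
    etaQuot p r₁ rₚ τ * cosetTerm r₁ rₚ (signedRow p (some x, 1)) τ =
      eisTerm p ((r₁ + rₚ) / 2) r₁ rₚ a τ x := by
  obtain ⟨γ, h00, h10, h11⟩ := exists_SL_of_index ha x
  rw [eisTerm_eq hp x h00 h10 h11, cosetTerm_eq hp h0 _ (γ := γ)
    (by rw [h10, h11]; simp [signedRow]; ring)]

lemma exists_isInverseChoice (p : ℕ) : ∃ a, IsInverseChoice p a := by
  have : ∀ x : EisIndex p, ∃ a : ℤ, a * x.1.2 ≡ 1 [ZMOD (x.1.1 : ℤ)] := by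
    intro x
    obtain ⟨u, v, h⟩ := Int.isCoprime_iff_gcd_eq_one.mpr x.2.2.2
    exact ⟨v, Int.modEq_iff_dvd.mpr ⟨u, by linarith⟩⟩
  choose a ha using this
  exact ⟨a, ha⟩

/-- The phases have modulus 1 and disappear. All convergence questions thus reduce to the series of
|cτ + d|^(-k), and the auxiliary choice of inverses leaves no trace. -/
lemma norm_etaQuot_mul_cosetTerm (hp : 0 < p) (h0 : r₁ + p * rₚ = 0) (v : bottomRows p) (τ : ℍ) :
    ‖etaQuot p r₁ rₚ τ * cosetTerm r₁ rₚ v τ‖ =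
      ‖(v.1 0 : ℂ) * τ + v.1 1‖ ^ (-((r₁ + rₚ) / 2 : ℝ)) := by
  obtain ⟨a, ha⟩ := exists_isInverseChoice p
  obtain ⟨⟨x, u⟩, rfl⟩ := (signedRow_bijective p).2 v
  cases x with
  | none =>
    rw [cosetTerm_none hp h0]
    rcases Int.units_eq_one_or u with rfl | rfl <;> simp [signedRow]
  | some x =>
    rw [cosetTerm_signedRow hp h0, cosetTerm_some hp h0 ha, norm_eisTerm]
    push_cast
    congr 1
    rcases Int.units_eq_one_or u with rfl | rfl
    · simp [signedRow]
    · simp only [signedRow, Units.val_neg, Units.val_one, neg_mul, one_mul, Matrix.cons_val_zero,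
        Matrix.cons_val_one, Matrix.cons_val_fin_one]
      rw [← norm_neg]
      congr 1
      push_cast
      ring

/-! ### Convergence, invariance and holomorphy of the coset sum -/

open Filter Topology

variable (p r₁ rₚ) in
/-- The sum of the inverses of the eta quotient over the translates by `Γ₀(p)`. -/
def cosetSum (τ : ℍ) : ℂ := ∑' v : bottomRows p, cosetTerm r₁ rₚ v τ

lemma summable_norm_linear_rpow {k : ℝ} (hk : 2 < k) (τ : ℍ) :
    Summable fun v : bottomRows p ↦ ‖(v.1 0 : ℂ) * τ + v.1 1‖ ^ (-k) := by
  refine Summable.of_nonneg_of_le (fun v ↦ by positivity)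
    (fun v ↦ EisensteinSeries.summand_bound τ (by linarith) v.1) (Summable.mul_left _ ?_)
  exact (EisensteinSeries.summable_one_div_norm_rpow hk).subtype _

lemma summable_cosetTerm (hp : 0 < p) (h0 : r₁ + p * rₚ = 0) (hk : 4 < r₁ + rₚ) (τ : ℍ) :
    Summable fun v : bottomRows p ↦ cosetTerm r₁ rₚ v τ := by
  have hk' : (2 : ℝ) < (r₁ + rₚ) / 2 := by
    have : (4 : ℝ) < r₁ + rₚ := by exact_mod_cast hk
    linarith
  rw [← summable_mul_left_iff (etaQuot_ne_zero (p := p) (r₁ := r₁) (rₚ := rₚ) τ),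
    ← summable_norm_iff]
  exact (summable_norm_linear_rpow hk' τ).congr fun v ↦
    (norm_etaQuot_mul_cosetTerm hp h0 v τ).symm

lemma summable_eisTerm (hp : 0 < p) (h0 : r₁ + p * rₚ = 0) (hk : 4 < r₁ + rₚ)
    {a : EisIndex p → ℤ} (ha : IsInverseChoice p a) (τ : ℍ) :
    Summable (eisTerm p ((r₁ + rₚ) / 2) r₁ rₚ a τ) := by
  have h := ((summable_cosetTerm hp h0 hk τ).mul_left (etaQuot p r₁ rₚ τ)).comp_injective
    (i := fun x ↦ signedRow p (some x, 1)) fun x y hxy ↦ by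
      simpa using (signedRow_bijective p).1 hxy
  exact h.congr fun x ↦ (cosetTerm_some hp h0 ha x τ)

/-- The factor 2 counts the signs ±(c, d); the rows (0, ±1) provide the leading 1 of the series. -/
lemma etaQuot_mul_cosetSum (hp : 0 < p) (h0 : r₁ + p * rₚ = 0) (hk : 4 < r₁ + rₚ)
    {a : EisIndex p → ℤ} (ha : IsInverseChoice p a) (τ : ℍ) :
    etaQuot p r₁ rₚ τ * cosetSum p r₁ rₚ τ =
      2 * eisInfty p ((r₁ + rₚ) / 2) r₁ rₚ a τ := by
  rw [cosetSum, tsum_bottomRows (summable_cosetTerm hp h0 hk τ)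
    fun x u ↦ cosetTerm_signedRow hp h0 x u τ, eisInfty]
  rw [mul_left_comm, mul_add, cosetTerm_none hp h0, ← tsum_mul_left]
  simp_rw [cosetTerm_some hp h0 ha]

lemma dvd_vecMul_zero (v : Fin 2 → ℤ) (hv : (p : ℤ) ∣ v 0) {γ : SL(2, ℤ)}
    (hγ : γ ∈ CongruenceSubgroup.Gamma0 p) : (p : ℤ) ∣ Matrix.vecMul v γ.1 0 := by
  rw [CongruenceSubgroup.Gamma0_mem, ZMod.intCast_zmod_eq_zero_iff_dvd] at hγ
  simp only [Matrix.vecMul, Matrix.vec2_dotProduct]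
  exact dvd_add (dvd_mul_of_dvd_left hv _) (dvd_mul_of_dvd_right hγ _)

/-- Right multiplication by an element of `Γ₀(p)` permutes the bottom rows. -/
def bottomRowsEquiv {γ : SL(2, ℤ)} (hγ : γ ∈ CongruenceSubgroup.Gamma0 p) :
    bottomRows p ≃ bottomRows p where
  toFun v := ⟨Matrix.vecMul v.1 γ.1, v.2.1.vecMulSL γ, dvd_vecMul_zero v.1 v.2.2 hγ⟩
  invFun v := ⟨Matrix.vecMul v.1 (γ⁻¹).1, v.2.1.vecMulSL γ⁻¹,
    dvd_vecMul_zero v.1 v.2.2 (inv_mem hγ)⟩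
  left_inv v := by
    simp_rw [Matrix.vecMul_vecMul, ← Matrix.SpecialLinearGroup.coe_mul, mul_inv_cancel,
      Matrix.SpecialLinearGroup.coe_one, Matrix.vecMul_one]
  right_inv v := by
    simp_rw [Matrix.vecMul_vecMul, ← Matrix.SpecialLinearGroup.coe_mul, inv_mul_cancel,
      Matrix.SpecialLinearGroup.coe_one, Matrix.vecMul_one]

/-- If γ_v has bottom row v, then γ_v γ has bottom row vγ, so the term of v at γτ is the term of vγ
at τ. -/
lemma cosetSum_smul (hp : 0 < p) (h0 : r₁ + p * rₚ = 0) {γ : SL(2, ℤ)}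
    (hγ : γ ∈ CongruenceSubgroup.Gamma0 p) (τ : ℍ) :
    cosetSum p r₁ rₚ (γ • τ) = cosetSum p r₁ rₚ τ := by
  rw [cosetSum, cosetSum, 
    ← (bottomRowsEquiv hγ).tsum_eq (fun v ↦ cosetTerm r₁ rₚ v τ)]
  refine tsum_congr fun v ↦ ?_
  suffices hrow : (bottomRowsEquiv hγ v).1 0 * (rowLift v * γ) 1 1 =
      (bottomRowsEquiv hγ v).1 1 * (rowLift v * γ) 1 0 by
    rw [cosetTerm_eq hp h0 (bottomRowsEquiv hγ v) hrow, cosetTerm, mul_smul]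
  simp only [bottomRowsEquiv, Equiv.coe_fn_mk, Matrix.vecMul, Matrix.vec2_dotProduct,
    Matrix.SpecialLinearGroup.coe_mul, Matrix.mul_apply, Fin.sum_univ_two, rowLift_zero,
    rowLift_one]
  ring

lemma differentiableOn_cosetTerm (hp : 0 < p) (v : bottomRows p) :
    DifferentiableOn ℂ (fun z ↦ cosetTerm r₁ rₚ v (ofComplex z)) upperHalfPlaneSet := by
  have hF : DifferentiableOn ℂ (fun z ↦ etaQuot p r₁ rₚ
      (((rowLift v 0 0 : ℤ) * z + (rowLift v 0 1 : ℤ)) /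
        ((rowLift v 1 0 : ℤ) * z + (rowLift v 1 1 : ℤ)))) upperHalfPlaneSet := by
    refine (differentiableOn_etaQuot hp).comp ?_ ?_
    · refine DifferentiableOn.div (by fun_prop) (by fun_prop) fun z hz ↦ ?_
      refine UpperHalfPlane.linear_ne_zero (cd := fun i ↦ ((rowLift v 1 i : ℤ) : ℝ)) ⟨z, hz⟩ ?_
        |> fun h ↦ by simpa using h
      intro h
      have h1 := congrFun h 0
      have h2 := congrFun h 1
      simp only [Pi.zero_apply, Int.cast_eq_zero] at h1 h2
      have := (rowLift v).det_coe
      rw [Matrix.det_fin_two, h1, h2] at this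
      simp at this
    · intro z hz
      have := (rowLift v • (⟨z, hz⟩ : ℍ)).2
      rw [coe_SL_smul] at this
      exact this
  refine (hF.inv fun z _ ↦ etaQuot_ne_zero _).congr fun z hz ↦ ?_
  rw [cosetTerm, coe_SL_smul, ofComplex_apply_of_im_pos hz]
  rfl

lemma differentiableOn_cosetSum (hp : 0 < p) (h0 : r₁ + p * rₚ = 0) (hk : 4 < r₁ + rₚ) :
    DifferentiableOn ℂ (fun z ↦ cosetSum p r₁ rₚ (ofComplex z)) upperHalfPlaneSet := by
  have hk' : (2 : ℝ) < (r₁ + rₚ) / 2 := by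
    have : (4 : ℝ) < r₁ + rₚ := by exact_mod_cast hk
    linarith
  -- After multiplication by the nowhere vanishing eta quotient the terms have norm |cz + d|^(-k),
  -- for which a summable majorant is uniform on vertical strips.
  suffices h : DifferentiableOn ℂ (fun z ↦ ∑' v : bottomRows p,
      etaQuot p r₁ rₚ z * cosetTerm r₁ rₚ v (ofComplex z)) upperHalfPlaneSet by
    refine (h.div (differentiableOn_etaQuot (r₁ := r₁) (rₚ := rₚ) hp)
      fun z _ ↦ etaQuot_ne_zero _).congr fun z _ ↦ ?_
    rw [Pi.div_apply, tsum_mul_left, mul_div_cancel_left₀ _ (etaQuot_ne_zero _), cosetSum]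
  intro z hz
  have hz' : 0 < z.im := hz
  set U : Set ℂ := {w | |w.re| < |z.re| + 1} ∩ {w | z.im / 2 < w.im} with hU
  have hUo : IsOpen U := (isOpen_lt (by fun_prop) continuous_const).inter
    (isOpen_lt continuous_const Complex.continuous_im)
  have hUsub : U ⊆ upperHalfPlaneSet := fun w hw ↦ by
    have : z.im / 2 < w.im := hw.2
    simp only [upperHalfPlaneSet, Set.mem_ofPred_eq]
    linarith
  have hzU : z ∈ U := ⟨lt_add_one |z.re|, half_lt_self hz'⟩
  refine DifferentiableAt.differentiableWithinAt (DifferentiableOn.differentiableAt (s := U) ?_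
    (hUo.mem_nhds hzU))
  refine differentiableOn_tsum_of_summable_norm
    (((EisensteinSeries.summable_one_div_norm_rpow hk').subtype (bottomRows p)).mul_left
      (EisensteinSeries.r ⟨⟨|z.re| + 1, z.im / 2⟩, half_pos hz'⟩ ^ (-((r₁ + rₚ) / 2 : ℝ))))
    (fun v ↦ ((differentiableOn_etaQuot hp).mul (differentiableOn_cosetTerm hp v)).mono hUsub)
    hUo fun v w hw ↦ ?_
  have hwH := hUsub hw
  have h := norm_etaQuot_mul_cosetTerm hp h0 v ⟨w, hwH⟩
  rw [ofComplex_apply_of_im_pos hwH]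
  refine h.le.trans (EisensteinSeries.summand_bound_of_mem_verticalStrip (z := ⟨w, hwH⟩)
    (by linarith) v.1 (half_pos hz') ⟨le_of_lt hw.1, le_of_lt hw.2⟩)

/-! ### Growth of the eta quotient and limits at i∞ -/

lemma norm_etaPow {z : ℂ} (hz : z ∈ upperHalfPlaneSet) (r : ℚ) :
    ‖etaPow r z‖ = ‖η z‖ ^ (r : ℝ) := by
  rw [etaPow, ← exp_logEta hz, Complex.norm_exp, Complex.norm_exp, ← Real.exp_mul]
  congr 1
  rw [show (r : ℂ) = ((r : ℝ) : ℂ) by push_cast; rfl, re_ofReal_mul, mul_comm]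

lemma norm_etaQuot (hp : 0 < p) {z : ℂ} (hz : z ∈ upperHalfPlaneSet) :
    ‖etaQuot p r₁ rₚ z‖ = ‖η z‖ ^ (r₁ : ℝ) * ‖η (p * z)‖ ^ (rₚ : ℝ) := by
  rw [etaQuot, norm_mul, norm_etaPow hz, norm_etaPow (natCast_mul_mem hp hz)]

lemma norm_eta_neg_inv {z : ℂ} (hz : z ∈ upperHalfPlaneSet) :
    ‖η (-1 / z)‖ = ‖z‖ ^ (1 / 2 : ℝ) * ‖η z‖ := by
  have hz0 : 0 < ‖z‖ := norm_pos_iff.mpr (slitPlane_ne_zero (mem_slitPlane_of_mem hz))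
  rw [← exp_logEta (neg_inv_mem hz), ← exp_logEta hz, logEta_neg_inv hz, Complex.norm_exp,
    Complex.norm_exp, Real.rpow_def_of_pos hz0, ← Real.exp_add]
  congr 1
  simp [Complex.log_re]
  ring

lemma norm_eta (z : ℂ) :
    ‖η z‖ = Real.exp (-(Real.pi * z.im / 12)) * ‖∏' n, (1 - eta_q n z)‖ := by
  rw [ModularForm.eta, norm_mul, Function.Periodic.norm_qParam]
  congr 2
  ring

lemma tendsto_norm_tprod :
    Tendsto (fun τ : ℍ ↦ ‖∏' n, (1 - eta_q n τ)‖) atImInfty (𝓝 1) := by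
  -- The available limit concerns the 24th power of the product; after passing to norms a real 24th
  -- root can be taken.
  have h := (tendsto_atImInfty_tprod_one_sub_eta_q_pow.norm).rpow_const
    (p := (1 / 24 : ℝ)) (Or.inl (by simp))
  rw [norm_one, Real.one_rpow] at h
  refine h.congr fun τ ↦ ?_
  rw [(multipliableLocallyUniformlyOn_eta.multipliable τ.2).tprod_pow, norm_pow,
    ← Real.rpow_natCast, ← Real.rpow_mul (norm_nonneg _)]
  norm_num

lemma ofReal_mul_mem {t : ℝ} (ht : 0 < t) {z : ℂ} (hz : z ∈ upperHalfPlaneSet) :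
    (t : ℂ) * z ∈ upperHalfPlaneSet := by
  have hz' : 0 < z.im := hz
  simpa [upperHalfPlaneSet] using mul_pos ht hz'

lemma tendsto_norm_tprod_mul {t : ℝ} (ht : 0 < t) :
    Tendsto (fun τ : ℍ ↦ ‖∏' n, (1 - eta_q n (t * τ))‖) atImInfty (𝓝 1) := by
  obtain ⟨g, hg⟩ : ∃ g : ℍ → ℍ, ∀ τ, (g τ : ℂ) = t * τ :=
    ⟨fun τ ↦ ⟨t * τ, ofReal_mul_mem ht τ.2⟩, fun _ ↦ rfl⟩
  have h : Tendsto g atImInfty atImInfty := by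
    rw [atImInfty, tendsto_comap_iff]
    refine (tendsto_comap.const_mul_atTop ht).congr fun τ ↦ ?_
    rw [Function.comp_apply, ← coe_im (g τ), hg, im_ofReal_mul, coe_im]
  refine (tendsto_norm_tprod.comp h).congr fun τ ↦ ?_
  simp only [Function.comp_apply, hg]

lemma tendsto_norm_tprod_rpow {t : ℝ} (ht : 0 < t) (r s : ℝ) :
    Tendsto (fun τ : ℍ ↦ ‖∏' n, (1 - eta_q n τ)‖ ^ r * ‖∏' n, (1 - eta_q n (t * τ))‖ ^ s)
      atImInfty (𝓝 1) := by
  have h1 := tendsto_norm_tprod.rpow_const (p := r) (Or.inl one_ne_zero)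
  have h2 := (tendsto_norm_tprod_mul ht).rpow_const (p := s) (Or.inl one_ne_zero)
  simpa using h1.mul h2

/-- Separates the leading exponential from a factor tending to 1. With t = p the exponent r₁ + p rₚ
vanishes, giving the limit at i∞; with t = 1/p it measures the decay at the cusp 0. -/
lemma norm_eta_rpow_mul (t r s : ℝ) (z : ℂ) :
    ‖η z‖ ^ r * ‖η (t * z)‖ ^ s = Real.exp (-(Real.pi * z.im / 12) * (r + t * s)) *
      (‖∏' n, (1 - eta_q n z)‖ ^ r * ‖∏' n, (1 - eta_q n (t * z))‖ ^ s) := by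
  rw [norm_eta, norm_eta, Real.mul_rpow (Real.exp_pos _).le (norm_nonneg _),
    Real.mul_rpow (Real.exp_pos _).le (norm_nonneg _), ← Real.exp_mul, ← Real.exp_mul,
    mul_mul_mul_comm, ← Real.exp_add, im_ofReal_mul]
  ring_nf

lemma tendsto_norm_etaQuot (hp : 0 < p) (h0 : r₁ + p * rₚ = 0) :
    Tendsto (fun τ : ℍ ↦ ‖etaQuot p r₁ rₚ τ‖) atImInfty (𝓝 1) := by
  have hp' : (0 : ℝ) < p := by exact_mod_cast hp
  refine (tendsto_norm_tprod_rpow hp' r₁ rₚ).congr fun τ ↦ ?_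
  have h0' : (r₁ : ℝ) + p * rₚ = 0 := by exact_mod_cast h0
  have h := norm_eta_rpow_mul p r₁ rₚ τ
  rw [h0', mul_zero, Real.exp_zero, one_mul] at h
  rw [norm_etaQuot hp τ.2, ← h]
  norm_cast

/-- Positivity on the imaginary axis turns the limit of the norm into a limit of the value, as the
final constant requires. -/
lemma etaQuot_I_mul (hp : 0 < p) {y : ℝ} (hy : 0 < y) :
    etaQuot p r₁ rₚ (Complex.I * y) = ‖etaQuot p r₁ rₚ (Complex.I * y)‖ := by
  have h1 : logEta (Complex.I * y) = ((logEta (Complex.I * y)).re : ℂ) :=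
    Complex.ext rfl (by rw [logEta_I_mul_im hy, ofReal_im])
  have h2 : logEta (Complex.I * (p * y : ℝ)) = ((logEta (Complex.I * (p * y : ℝ))).re : ℂ) :=
    Complex.ext rfl (by rw [logEta_I_mul_im (by positivity), ofReal_im])
  have h3 : (p : ℂ) * (Complex.I * y) = Complex.I * (p * y : ℝ) := by push_cast; ring
  rw [etaQuot_eq_exp, h3, h1, h2, ← ofReal_ratCast, ← ofReal_ratCast, ← ofReal_mul, ← ofReal_mul,
    ← ofReal_add, ← ofReal_exp, norm_real, Real.norm_of_nonneg (Real.exp_pos _).le]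

/-- The point `iy` of the upper half plane, for `y > 0`. -/
def imagPoint (y : {y : ℝ // 0 < y}) : ℍ := ⟨Complex.I * (y.1 : ℂ), by simpa using y.2⟩

lemma tendsto_imagPoint :
    Tendsto imagPoint (comap Subtype.val atTop) atImInfty := by
  rw [atImInfty, tendsto_comap_iff]
  refine tendsto_comap.congr fun y ↦ ?_
  simp [imagPoint]

instance : (comap (Subtype.val : {y : ℝ // 0 < y} → ℝ) atTop).NeBot := by
  refine comap_neBot_iff_frequently.mpr (Eventually.frequently ?_)
  filter_upwards [eventually_gt_atTop 0] with t ht using ⟨⟨t, ht⟩, rfl⟩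

lemma tendsto_etaQuot_imagPoint (hp : 0 < p) (h0 : r₁ + p * rₚ = 0) :
    Tendsto (fun y ↦ etaQuot p r₁ rₚ (imagPoint y)) (comap Subtype.val atTop) (𝓝 1) := by
  have h := ((Complex.continuous_ofReal.tendsto 1).comp
    ((tendsto_norm_etaQuot hp h0).comp tendsto_imagPoint))
  rw [ofReal_one] at h
  exact h.congr fun y ↦ (etaQuot_I_mul hp y.2).symm

lemma tendsto_norm_linear_rpow {c d : ℝ} (hc : c ≠ 0) {k : ℝ} (hk : 0 < k) :
    Tendsto (fun τ : ℍ ↦ ‖(c : ℂ) * τ + d‖ ^ (-k)) atImInfty (𝓝 0) := by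
  refine (tendsto_rpow_neg_atTop hk).comp ?_
  refine tendsto_atTop_mono (fun τ ↦ ?_) (tendsto_comap.const_mul_atTop (abs_pos.mpr hc))
  have := abs_im_le_norm ((c : ℂ) * τ + d)
  simpa [abs_mul, abs_of_pos τ.im_pos] using this

/-- Every term of the sum has c > 0 and so tends to 0; the majorant on Im τ ≥ 1 allows dominated
convergence. -/
lemma tendsto_eisInfty_imagPoint (hk : 4 < r₁ + rₚ) (a : EisIndex p → ℤ) :
    Tendsto (fun y ↦ eisInfty p ((r₁ + rₚ) / 2) r₁ rₚ a (imagPoint y)) (comap Subtype.val atTop)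
      (𝓝 1) := by
  have hk' : (2 : ℝ) < (r₁ + rₚ) / 2 := by
    have : (4 : ℝ) < r₁ + rₚ := by exact_mod_cast hk
    linarith
  have hinj : Function.Injective fun x : EisIndex p ↦ (![(x.1.1 : ℤ), x.1.2] : Fin 2 → ℤ) := by
    rintro ⟨⟨c, d⟩, hx⟩ ⟨⟨c', d'⟩, hx'⟩ h
    have h1 := congrFun h 0
    have h2 := congrFun h 1
    simp only [Matrix.cons_val_zero, Matrix.cons_val_one, Matrix.cons_val_fin_one,
      Nat.cast_inj] at h1 h2
    subst h1 h2
    rfl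
  have h := tendsto_tsum_of_dominated_convergence (𝓕 := comap Subtype.val atTop)
    (f := fun y ↦ eisTerm p ((r₁ + rₚ) / 2) r₁ rₚ a (imagPoint y)) (g := fun _ ↦ 0)
    (((EisensteinSeries.summable_one_div_norm_rpow hk').comp_injective hinj).mul_left
      (EisensteinSeries.r ⟨⟨0, 1⟩, one_pos⟩ ^ (-((r₁ + rₚ) / 2 : ℝ)))) ?_ ?_
  · simpa [eisInfty] using h.const_add 1
  · intro x
    rw [tendsto_zero_iff_norm_tendsto_zero]
    have hc : (x.1.1 : ℝ) ≠ 0 := by exact_mod_cast x.2.1.ne'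
    refine ((tendsto_norm_linear_rpow (d := x.1.2) hc (by linarith : 0 < (r₁ + rₚ : ℝ) / 2)).comp
      tendsto_imagPoint).congr fun y ↦ ?_
    rw [norm_eisTerm]
    push_cast
    rfl
  · have h1 : ∀ᶠ y in comap (Subtype.val : {y : ℝ // 0 < y} → ℝ) atTop, 1 ≤ y.1 :=
      tendsto_comap.eventually (eventually_ge_atTop 1)
    filter_upwards [h1] with y hy x
    rw [norm_eisTerm]
    have := EisensteinSeries.summand_bound_of_mem_verticalStrip (z := imagPoint y) (A := 0)
      (k := (r₁ + rₚ : ℝ) / 2) (by linarith) ![(x.1.1 : ℤ), x.1.2] one_pos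
      ⟨by simp [imagPoint], by simpa [imagPoint] using hy⟩
    push_cast
    simpa using this

/-! ### Boundedness of the coset sum at the cusps i∞ and 0 -/

lemma T_zpow_mem_Gamma0 (m : ℤ) : ModularGroup.T ^ m ∈ CongruenceSubgroup.Gamma0 p := by
  rw [CongruenceSubgroup.Gamma0_mem, ModularGroup.coe_T_zpow]
  simp

lemma coe_S_inv : (ModularGroup.S⁻¹ : SL(2, ℤ)).1 = !![0, 1; -1, 0] := by
  rw [Matrix.SpecialLinearGroup.coe_inv, ModularGroup.coe_S, Matrix.adjugate_fin_two_of, neg_neg]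

/-- The product is (1, 0; -pm, 1): translations by multiples of p act at the cusp 0. -/
lemma S_mul_T_zpow_mul_S_inv_mem_Gamma0 (m : ℤ) :
    ModularGroup.S * ModularGroup.T ^ (p * m : ℤ) * ModularGroup.S⁻¹ ∈
      CongruenceSubgroup.Gamma0 p := by
  rw [CongruenceSubgroup.Gamma0_mem]
  simp only [Matrix.SpecialLinearGroup.coe_mul, ModularGroup.coe_T_zpow, ModularGroup.coe_S,
    coe_S_inv]
  simp

lemma cosetSum_S_smul_T_zpow (hp : 0 < p) (h0 : r₁ + p * rₚ = 0) (m : ℤ) (τ : ℍ) :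
    cosetSum p r₁ rₚ (ModularGroup.S • ModularGroup.T ^ (p * m : ℤ) • τ) =
      cosetSum p r₁ rₚ (ModularGroup.S • τ) := by
  rw [← cosetSum_smul hp h0 (S_mul_T_zpow_mul_S_inv_mem_Gamma0 m) (ModularGroup.S • τ)]
  simp only [mul_smul, inv_smul_smul]

/-- Every point can be translated by a multiple of `h` into a vertical strip. -/
lemma exists_T_zpow_smul_re {h : ℕ} (hh : 0 < h) (τ : ℍ) :
    ∃ m : ℤ, |(ModularGroup.T ^ (h * m : ℤ) • τ).re| ≤ h ∧
      (ModularGroup.T ^ (h * m : ℤ) • τ).im = τ.im := by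
  have hh' : (0 : ℝ) < h := by exact_mod_cast hh
  refine ⟨-⌊τ.re / h⌋, ?_, ?_⟩
  · rw [← coe_re, ModularGroup.coe_T_zpow_smul_eq]
    have h1 := Int.floor_le (τ.re / h)
    have h2 := Int.lt_floor_add_one (τ.re / h)
    rw [le_div_iff₀ hh'] at h1
    rw [div_lt_iff₀ hh'] at h2
    simp only [add_re, coe_re, intCast_re]
    push_cast
    rw [abs_le]
    constructor <;> nlinarith
  · rw [← coe_im, ModularGroup.coe_T_zpow_smul_eq]
    simp

/-- On the strip |Re τ| ≤ 1, Im τ ≥ 1 the product F·G is bounded by `C`, and |F| > 1/2 high up,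
whence the bound 2C. Invariance under translation removes the strip. -/
lemma isBoundedAtImInfty_cosetSum (hp : 0 < p) (h0 : r₁ + p * rₚ = 0) (hk : 4 < r₁ + rₚ) :
    IsBoundedAtImInfty (cosetSum p r₁ rₚ) := by
  have hk' : (2 : ℝ) < (r₁ + rₚ) / 2 := by
    have : (4 : ℝ) < r₁ + rₚ := by exact_mod_cast hk
    linarith
  have hF : ∀ᶠ τ : ℍ in atImInfty, 1 / 2 < ‖etaQuot p r₁ rₚ τ‖ :=
    (tendsto_norm_etaQuot hp h0).eventually_const_lt (by norm_num)
  obtain ⟨A, hA⟩ := (atImInfty_mem _).mp hF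
  set C : ℝ := EisensteinSeries.r ⟨⟨1, 1⟩, one_pos⟩ ^ (-((r₁ + rₚ) / 2 : ℝ)) *
    ∑' v : bottomRows p, ‖v.1‖ ^ (-((r₁ + rₚ) / 2 : ℝ)) with hC
  have hsum := (EisensteinSeries.summable_one_div_norm_rpow hk').subtype (bottomRows p)
  rw [isBoundedAtImInfty_iff]
  refine ⟨2 * C, max A 1, fun τ hτ ↦ ?_⟩
  obtain ⟨m, hre, him⟩ := exists_T_zpow_smul_re one_pos τ
  rw [← cosetSum_smul hp h0 (T_zpow_mem_Gamma0 ((1 : ℕ) * m)) τ]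
  set τ' := ModularGroup.T ^ ((1 : ℕ) * m : ℤ) • τ with hτ'
  have hA' : 1 / 2 < ‖etaQuot p r₁ rₚ τ'‖ := hA τ' (by rw [him]; exact (le_max_left _ _).trans hτ)
  have hbound : ‖etaQuot p r₁ rₚ τ' * cosetSum p r₁ rₚ τ'‖ ≤ C := by
    rw [cosetSum, ← tsum_mul_left, hC, ← tsum_mul_left]
    refine tsum_of_norm_bounded (hsum.mul_left _).hasSum fun v ↦ ?_
    rw [norm_etaQuot_mul_cosetTerm hp h0]
    exact EisensteinSeries.summand_bound_of_mem_verticalStrip (by linarith) v.1 one_pos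
      ⟨by simpa using hre, by rw [him]; exact (le_max_right _ _).trans hτ⟩
  rw [norm_mul] at hbound
  nlinarith [norm_nonneg (cosetSum p r₁ rₚ τ')]

/-- At the cusp 0 the entry d becomes the coefficient of τ, so this makes every term decay there. -/
lemma bottomRows_one_ne_zero (hp : 1 < p) (v : bottomRows p) : v.1 1 ≠ 0 := by
  intro h
  have h1 := v.2.1
  rw [h, isCoprime_zero_right] at h1
  have h2 : (p : ℤ) ∣ 1 := v.2.2.trans h1.dvd
  have := Int.eq_one_of_dvd_one (by positivity) h2
  omega

lemma coe_S_smul (τ : ℍ) : ((ModularGroup.S • τ : ℍ) : ℂ) = -1 / τ := by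
  rw [modular_S_smul]
  simp [neg_div, inv_neg]

lemma norm_etaQuot_S_smul (hp : 0 < p) (τ : ℍ) :
    ‖etaQuot p r₁ rₚ (ModularGroup.S • τ : ℍ)‖ = ‖(τ : ℂ)‖ ^ ((r₁ + rₚ) / 2 : ℝ) *
      ((p : ℝ) ^ (-(rₚ / 2) : ℝ) *
        (‖η τ‖ ^ (r₁ : ℝ) * ‖η ((p⁻¹ : ℝ) * τ)‖ ^ (rₚ : ℝ))) := by
  have hp' : (0 : ℝ) < p := by exact_mod_cast hp
  have hτ : (τ : ℂ) ∈ upperHalfPlaneSet := τ.2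
  have hτ0 : 0 < ‖(τ : ℂ)‖ := norm_pos_iff.mpr τ.ne_zero
  have hτp := ofReal_mul_mem (inv_pos.mpr hp') hτ
  have e1 : (p : ℂ) * (-1 / τ) = -1 / ((p⁻¹ : ℝ) * τ) := by
    have := τ.ne_zero
    push_cast
    field_simp
  rw [norm_etaQuot hp (ModularGroup.S • τ).2, coe_S_smul, e1, norm_eta_neg_inv hτ,
    norm_eta_neg_inv hτp, norm_mul, norm_real, Real.norm_of_nonneg (inv_pos.mpr hp').le,
    Real.mul_rpow (by positivity) (by positivity), Real.mul_rpow (by positivity) (by positivity),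
    Real.mul_rpow (by positivity) (by positivity), Real.mul_rpow (by positivity) (by positivity),
    ← Real.rpow_mul (norm_nonneg _), ← Real.rpow_mul (norm_nonneg _), ← Real.rpow_mul
    (inv_pos.mpr hp').le, Real.inv_rpow hp'.le, ← Real.rpow_neg hp'.le,
    show ((r₁ + rₚ) / 2 : ℝ) = 1 / 2 * r₁ + 1 / 2 * rₚ by ring, Real.rpow_add hτ0,
    show (-(1 / 2 * (rₚ : ℝ))) = -(rₚ / 2) by ring]
  ring

/-- The size of a term at the cusp `0`. -/
lemma norm_cosetTerm_S_smul (hp : 0 < p) (h0 : r₁ + p * rₚ = 0) (v : bottomRows p) (τ : ℍ) :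
    ‖cosetTerm r₁ rₚ v (ModularGroup.S • τ)‖ *
      (‖η τ‖ ^ (r₁ : ℝ) * ‖η ((p⁻¹ : ℝ) * τ)‖ ^ (rₚ : ℝ)) =
      (p : ℝ) ^ (rₚ / 2 : ℝ) *
        ‖((v.1 1 : ℝ) : ℂ) * τ + (-(v.1 0) : ℝ)‖ ^ (-((r₁ + rₚ) / 2 : ℝ)) := by
  have hp' : (0 : ℝ) < p := by exact_mod_cast hp
  have hτ0 : 0 < ‖(τ : ℂ)‖ := norm_pos_iff.mpr τ.ne_zero
  have h1 := norm_etaQuot_mul_cosetTerm hp h0 v (ModularGroup.S • τ)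
  have e1 : (v.1 0 : ℂ) * ((ModularGroup.S • τ : ℍ) : ℂ) + v.1 1 =
      (((v.1 1 : ℝ) : ℂ) * τ + (-(v.1 0) : ℝ)) / τ := by
    have := τ.ne_zero
    rw [coe_S_smul]
    push_cast
    field_simp
    ring
  rw [e1, norm_div, Real.div_rpow (norm_nonneg _) (norm_nonneg _), Real.rpow_neg hτ0.le,
    div_inv_eq_mul, norm_mul, norm_etaQuot_S_smul hp, Real.rpow_neg hp'.le (rₚ / 2)] at h1
  have hx : (‖(τ : ℂ)‖ ^ ((r₁ + rₚ) / 2 : ℝ)) ≠ 0 := (Real.rpow_pos_of_pos hτ0 _).ne'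
  have hy : ((p : ℝ) ^ (rₚ / 2 : ℝ)) ≠ 0 := (Real.rpow_pos_of_pos hp' _).ne'
  apply mul_left_cancel₀ hx
  field_simp at h1 ⊢
  linear_combination h1

/-- Inversion turns the row (c, d) into (d, -c) with d ≠ 0, so no constant term survives. The bound
on the real part supplies the majorant for dominated convergence. -/
lemma tendsto_tsum_linear_rpow (hp : 1 < p) {k : ℝ} (hk : 2 < k) (A : ℝ) :
    Tendsto (fun τ : ℍ ↦ ∑' v : bottomRows p,
      ‖((v.1 1 : ℝ) : ℂ) * τ + (-(v.1 0) : ℝ)‖ ^ (-k)) (atImInfty ⊓ 𝓟 {τ | |τ.re| ≤ A}) (𝓝 0) := by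
  have hinj : Function.Injective fun v : bottomRows p ↦ (![v.1 1, -v.1 0] : Fin 2 → ℤ) := by
    intro v w h
    have h1 := congrFun h 0
    have h2 := congrFun h 1
    simp only [Matrix.cons_val_zero, Matrix.cons_val_one, Matrix.cons_val_fin_one, neg_inj] at h1 h2
    apply Subtype.ext
    funext i
    fin_cases i
    · exact h2
    · exact h1
  rw [show (0 : ℝ) = ∑' _ : bottomRows p, (0 : ℝ) by simp]
  refine tendsto_tsum_of_dominated_convergence
    (((EisensteinSeries.summable_one_div_norm_rpow hk).comp_injective hinj).mul_left
      (EisensteinSeries.r ⟨⟨A, 1⟩, one_pos⟩ ^ (-k))) (fun v ↦ ?_) ?_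
  · exact (tendsto_norm_linear_rpow (by exact_mod_cast bottomRows_one_ne_zero hp v)
      (by linarith)).mono_left inf_le_left
  · have h1 : ∀ᶠ τ : ℍ in atImInfty, 1 ≤ τ.im := tendsto_comap.eventually (eventually_ge_atTop 1)
    rw [eventually_inf_principal]
    filter_upwards [h1] with τ hτ hre v
    have := EisensteinSeries.summand_bound_of_mem_verticalStrip (z := τ) (A := A)
      (k := k) (by linarith) ![v.1 1, -v.1 0] one_pos ⟨hre, hτ⟩
    rw [Real.norm_of_nonneg (by positivity)]
    simpa using this

/-- Here the hypothesis `p r₁ + rₚ ≤ 24` on the order of vanishing at the cusp `0` enters. -/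
lemma tendsto_cosetSum_S_smul_mul_exp (hp : 1 < p) (h0 : r₁ + p * rₚ = 0) (hk : 4 < r₁ + rₚ)
    (hn : p * r₁ + rₚ ≤ 24) :
    Tendsto (fun τ : ℍ ↦ ‖cosetSum p r₁ rₚ (ModularGroup.S • τ)‖ *
      Real.exp (-2 * Real.pi * τ.im / p)) atImInfty (𝓝 0) := by
  have hp0 : 0 < p := by omega
  have hp' : (0 : ℝ) < p := by exact_mod_cast hp0
  have hk' : (2 : ℝ) < (r₁ + rₚ) / 2 := by
    have : (4 : ℝ) < r₁ + rₚ := by exact_mod_cast hk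
    linarith
  have hn' : (p : ℝ) * r₁ + rₚ ≤ 24 := by exact_mod_cast hn
  have hP := (tendsto_norm_tprod_rpow (inv_pos.mpr hp') r₁ rₚ).eventually_const_lt
    (show (1 / 2 : ℝ) < 1 by norm_num)
  have hstrip : Tendsto (fun τ : ℍ ↦ ‖cosetSum p r₁ rₚ (ModularGroup.S • τ)‖ *
      Real.exp (-2 * Real.pi * τ.im / p)) (atImInfty ⊓ 𝓟 {τ | |τ.re| ≤ p}) (𝓝 0) := by
    have hlim := (tendsto_tsum_linear_rpow hp hk' p).const_mul (2 * (p : ℝ) ^ (rₚ / 2 : ℝ))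
    rw [mul_zero] at hlim
    refine squeeze_zero' (Eventually.of_forall fun τ ↦ by positivity) ?_ hlim
    refine (hP.filter_mono inf_le_left).mono fun τ hτ ↦ ?_
    have hsum := (summable_cosetTerm hp0 h0 hk (ModularGroup.S • τ)).norm
    set W : ℝ := ‖η τ‖ ^ (r₁ : ℝ) * ‖η ((p⁻¹ : ℝ) * τ)‖ ^ (rₚ : ℝ) with hW
    -- The bound p r₁ + rₚ ≤ 24 gives r₁ + rₚ/p ≤ 24/p, so the left side is at most the exponential
    -- part of `W`. The factor 2 compensates for the infinite products, which exceed 1/2.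
    have hWexp : Real.exp (-2 * Real.pi * τ.im / p) ≤ 2 * W := by
      have hexp : Real.exp (-2 * Real.pi * τ.im / p) ≤
          Real.exp (-(Real.pi * (τ : ℂ).im / 12) * (r₁ + (p : ℝ)⁻¹ * rₚ)) := by
        rw [Real.exp_le_exp, coe_im]
        have : (r₁ : ℝ) + (p : ℝ)⁻¹ * rₚ ≤ 24 / p := by
          rw [le_div_iff₀ hp']
          field_simp
          linarith
        have hy : 0 ≤ Real.pi * τ.im / 12 := by have := τ.im_pos; positivity
        calc -2 * Real.pi * τ.im / p = -(Real.pi * τ.im / 12) * (24 / p) := by ring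
          _ ≤ _ := by nlinarith
      rw [hW, norm_eta_rpow_mul]
      nlinarith [Real.exp_pos (-(Real.pi * (τ : ℂ).im / 12) * (r₁ + (p : ℝ)⁻¹ * rₚ))]
    calc ‖cosetSum p r₁ rₚ (ModularGroup.S • τ)‖ * Real.exp (-2 * Real.pi * τ.im / p)
        ≤ (∑' v : bottomRows p, ‖cosetTerm r₁ rₚ v (ModularGroup.S • τ)‖) * (2 * W) :=
          mul_le_mul (norm_tsum_le_tsum_norm hsum) hWexp (Real.exp_pos _).le
            (tsum_nonneg fun _ ↦ norm_nonneg _)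
      _ = 2 * ∑' v : bottomRows p, ‖cosetTerm r₁ rₚ v (ModularGroup.S • τ)‖ * W := by
          rw [tsum_mul_right]; ring
      _ = _ := by
          simp_rw [hW, norm_cosetTerm_S_smul hp0 h0, tsum_mul_left, mul_assoc]
  -- Periodicity with period p carries the limit from the strip to the whole half plane.
  rw [Metric.tendsto_nhds] at hstrip ⊢
  intro ε hε
  have h1 := hstrip ε hε
  rw [eventually_inf_principal] at h1
  obtain ⟨A, hA⟩ := (atImInfty_mem _).mp h1
  refine (atImInfty_mem _).mpr ⟨A, fun τ hτ ↦ ?_⟩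
  obtain ⟨m, hre, him⟩ := exists_T_zpow_smul_re hp0 τ
  have h2 := hA (ModularGroup.T ^ (p * m : ℤ) • τ) (by rw [him]; exact hτ) hre
  rwa [him, cosetSum_S_smul_T_zpow hp0 h0] at h2

/-- In the local parameter q = e(z/p), G∘S is holomorphic on a punctured disc and q·G∘S tends to 0.
The removable singularity then has a zero at q = 0, so q·G∘S = O(q) and G∘S is bounded. -/
lemma isBoundedAtImInfty_cosetSum_S (hp : 1 < p) (h0 : r₁ + p * rₚ = 0) (hk : 4 < r₁ + rₚ)
    (hn : p * r₁ + rₚ ≤ 24) :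
    IsBoundedAtImInfty fun τ ↦ cosetSum p r₁ rₚ (ModularGroup.S • τ) := by
  have hp0 : 0 < p := by omega
  have hp' : (0 : ℝ) < p := by exact_mod_cast hp0
  set ψ : ℂ → ℂ := fun z ↦ cosetSum p r₁ rₚ (ModularGroup.S • ofComplex z) with hψ
  have hper : Function.Periodic ψ (p : ℝ) := by
    intro w
    by_cases! hw : 0 < w.im
    · have hw' : 0 < (w + (p : ℝ)).im := by simp [hw]
      have : (⟨w + (p : ℝ), hw'⟩ : ℍ) = ModularGroup.T ^ (p * 1 : ℤ) • ⟨w, hw⟩ := by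
        ext
        rw [ModularGroup.coe_T_zpow_smul_eq]
        simp
      simp only [hψ]
      rw [ofComplex_apply_of_im_pos hw, ofComplex_apply_of_im_pos hw', this,
        cosetSum_S_smul_T_zpow hp0 h0]
    -- Off the upper half plane `ofComplex` takes one fixed value, so periodicity is automatic
    -- there.
    · have hw' : (w + (p : ℝ)).im ≤ 0 := by simpa using hw
      simp only [hψ, ofComplex_apply_of_im_nonpos hw, ofComplex_apply_of_im_nonpos hw']
  have hq : Function.Periodic (Function.Periodic.qParam p) (p : ℝ) := by
    intro w
    have hpc : (p : ℂ) ≠ 0 := by exact_mod_cast hp0.ne'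
    rw [Function.Periodic.qParam, Function.Periodic.qParam,
      show 2 * Real.pi * Complex.I * (w + (p : ℝ)) / (p : ℝ) =
        2 * Real.pi * Complex.I * w / (p : ℝ) + 2 * Real.pi * Complex.I by push_cast; field_simp,
      Complex.exp_periodic]
  have hdiff : ∀ z : ℂ, 0 < z.im → DifferentiableAt ℂ ψ z := by
    intro z hz
    have h1 : DifferentiableAt ℂ (fun z ↦ cosetSum p r₁ rₚ (ofComplex z)) (-1 / z) :=
      (differentiableOn_cosetSum hp0 h0 hk).differentiableAt
        (isOpen_upperHalfPlaneSet.mem_nhds (neg_inv_mem hz))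
    have h2 : DifferentiableAt ℂ (fun z : ℂ ↦ -1 / z) z :=
      (differentiableAt_const _).div differentiableAt_id
        (slitPlane_ne_zero (mem_slitPlane_of_mem hz))
    refine (h1.comp z h2).congr_of_eventuallyEq ?_
    filter_upwards [isOpen_upperHalfPlaneSet.mem_nhds hz] with w hw
    simp only [hψ, Function.comp_apply]
    congr 1
    rw [ofComplex_apply_of_im_pos hw, ofComplex_apply_of_im_pos (neg_inv_mem hw)]
    ext
    rw [coe_S_smul]
  have hz : (comap Complex.im atTop).ZeroAtFilter
      (fun z ↦ ψ z * Function.Periodic.qParam p z) := by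
    rw [ZeroAtFilter, tendsto_zero_iff_norm_tendsto_zero]
    refine ((tendsto_cosetSum_S_smul_mul_exp hp h0 hk hn).comp tendsto_comap_im_ofComplex).congr' ?_
    filter_upwards [preimage_mem_comap (Ioi_mem_atTop 0)] with z hz
    rw [norm_mul, Function.Periodic.norm_qParam, Function.comp_apply, ← coe_im,
      ofComplex_apply_of_im_pos hz]
    simp only [hψ, ofComplex_apply_of_im_pos hz]
  have hO := Function.Periodic.exp_decay_of_zero_at_inf hp' (hper.mul hq) (by
    filter_upwards [preimage_mem_comap (Ioi_mem_atTop 0)] with z hz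
    exact (hdiff z hz).mul (Function.Periodic.differentiable_qParam z)) hz
  have hO2 : ψ =O[comap Complex.im atTop] (1 : ℂ → ℝ) := by
    refine Asymptotics.IsBigO.of_norm_left ?_
    -- The decay rate exp(-2π Im z / p) is exactly |q|, so multiplying by q⁻¹ leaves a bounded
    -- function.
    have h3 := hO.mul (Asymptotics.isBigO_refl
      (fun z : ℂ ↦ (Function.Periodic.qParam p z)⁻¹) (comap Complex.im atTop)).norm_right
    refine (h3.norm_left).congr (fun z ↦ ?_) fun z ↦ ?_
    · simp only [Pi.mul_apply]
      rw [mul_assoc, mul_inv_cancel₀ (Function.Periodic.qParam_ne_zero z), mul_one]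
    · rw [norm_inv, Function.Periodic.norm_qParam, mul_inv_cancel₀ (Real.exp_pos _).ne']
      rfl
  have h4 := hO2.comp_tendsto tendsto_coe_atImInfty
  refine h4.congr (fun τ ↦ ?_) fun τ ↦ rfl
  simp [hψ]

/-! ### The coset sum is constant -/

/-- An element of `SL(2, ℤ)` lies in `Γ₀(p)` or in `Γ₀(p) S Tʲ` for some `j`. -/
lemma mem_Gamma0_or_exists (hp : p.Prime) (γ : SL(2, ℤ)) :
    γ ∈ CongruenceSubgroup.Gamma0 p ∨ ∃ γ₀ ∈ CongruenceSubgroup.Gamma0 p, ∃ j : ℤ,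
      γ = γ₀ * ModularGroup.S * ModularGroup.T ^ j := by
  have := Fact.mk hp
  by_cases h : ((γ 1 0 : ℤ) : ZMod p) = 0
  · exact Or.inl (CongruenceSubgroup.Gamma0_mem.mpr h)
  · right
    -- The lower left entry of γT⁻ʲS⁻¹ is cj - d, which vanishes mod p for j ≡ d/c.
    obtain ⟨j, hj⟩ := ZMod.intCast_surjective (((γ 1 1 : ℤ) : ZMod p) / ((γ 1 0 : ℤ) : ZMod p))
    refine ⟨γ * ModularGroup.T ^ (-j) * ModularGroup.S⁻¹, ?_, j, by group⟩
    rw [CongruenceSubgroup.Gamma0_mem]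
    have h1 : (γ * ModularGroup.T ^ (-j) * ModularGroup.S⁻¹) 1 0 = γ 1 0 * j - γ 1 1 := by
      simp only [Matrix.SpecialLinearGroup.coe_mul, ModularGroup.coe_T_zpow, coe_S_inv,
        Matrix.mul_apply, Fin.sum_univ_two]
      simp
      ring
    rw [h1]
    push_cast
    rw [hj]
    field_simp
    ring

lemma isBoundedAtImInfty_cosetSum_smul (hp : p.Prime) (h0 : r₁ + p * rₚ = 0) (hk : 4 < r₁ + rₚ)
    (hn : p * r₁ + rₚ ≤ 24) (γ : SL(2, ℤ)) :
    IsBoundedAtImInfty fun τ ↦ cosetSum p r₁ rₚ (γ • τ) := by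
  rcases mem_Gamma0_or_exists hp γ with h | ⟨γ₀, h, j, rfl⟩
  · simpa only [cosetSum_smul hp.pos h0 h] using isBoundedAtImInfty_cosetSum hp.pos h0 hk
  · simp only [mul_smul, cosetSum_smul hp.pos h0 h]
    obtain ⟨M, A, hM⟩ :=
      isBoundedAtImInfty_iff.mp (isBoundedAtImInfty_cosetSum_S hp.one_lt h0 hk hn)
    refine isBoundedAtImInfty_iff.mpr ⟨M, A, fun τ hτ ↦ hM _ ?_⟩
    rw [← coe_im, ModularGroup.coe_T_zpow_smul_eq]
    simpa using hτ

variable (r₁ rₚ) in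
/-- The sum over cosets as a modular form of weight zero. -/
def cosetSumForm (hp : p.Prime) (h0 : r₁ + p * rₚ = 0) (hk : 4 < r₁ + rₚ)
    (hn : p * r₁ + rₚ ≤ 24) :
    ModularForm (CongruenceSubgroup.Gamma0 p : Subgroup (GL (Fin 2) ℝ)) 0 where
  toFun := cosetSum p r₁ rₚ
  slash_action_eq' A hA := by
    obtain ⟨γ, hγ, rfl⟩ := hA
    change cosetSum p r₁ rₚ ∣[(0 : ℤ)] γ = _
    ext τ
    rw [SL_slash_apply, cosetSum_smul hp.pos h0 hγ]
    simp
  holo' := by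
    rw [UpperHalfPlane.mdifferentiable_iff]
    exact differentiableOn_cosetSum hp.pos h0 hk
  bdd_at_cusps' {c} hc := by
    have := NeZero.mk hp.ne_zero
    rw [Subgroup.IsArithmetic.isCusp_iff_isCusp_SL2Z] at hc
    rw [OnePoint.isBoundedAt_iff_forall_SL2Z hc]
    intro γ _
    refine (isBoundedAtImInfty_cosetSum_smul hp h0 hk hn γ).congr_left fun τ ↦ ?_
    rw [SL_slash_apply]
    simp

/-- The Eisenstein series equals the eta quotient. -/
theorem eisInfty_eq_etaQuot (hp : p.Prime) (h0 : r₁ + p * rₚ = 0) (hk : 4 < r₁ + rₚ)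
    (hn : p * r₁ + rₚ ≤ 24) {a : EisIndex p → ℤ} (ha : IsInverseChoice p a) (τ : ℍ) :
    eisInfty p ((r₁ + rₚ) / 2) r₁ rₚ a τ = etaQuot p r₁ rₚ τ := by
  have := NeZero.mk hp.ne_zero
  obtain ⟨C, hC⟩ := ModularForm.eq_const_of_weight_zero (cosetSumForm r₁ rₚ hp h0 hk hn)
  have hC' : ∀ τ, cosetSum p r₁ rₚ τ = C := fun τ ↦ congrFun hC τ
  have hE : ∀ τ : ℍ, etaQuot p r₁ rₚ τ * C = 2 * eisInfty p ((r₁ + rₚ) / 2) r₁ rₚ a τ :=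
    fun τ ↦ by rw [← hC' τ, etaQuot_mul_cosetSum hp.pos h0 hk ha]
  have hl := (tendsto_etaQuot_imagPoint hp.pos h0).mul_const C
  have hr := (tendsto_eisInfty_imagPoint hk a).const_mul 2
  -- Both sides of F·C = 2E are compared as y → ∞ along iy, where F → 1 and E → 1.
  have hC2 : 1 * C = 2 * 1 := tendsto_nhds_unique (hl.congr fun y ↦ hE _) hr
  have := hE τ
  rw [one_mul, mul_one] at hC2
  rw [hC2] at this
  exact mul_left_cancel₀ two_ne_zero (by rw [← this, mul_comm])

end RationalWeight

end

theorem theorem7p1 :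
    (∀ n₁ : ℚ, 1 / 2 < n₁ → n₁ ≤ 1 →
      ∀ a : RationalWeight.EisIndex 2 → ℤ, RationalWeight.IsInverseChoice 2 a →
      ∀ τ : UpperHalfPlane,
        Summable (RationalWeight.eisTerm 2 (4 * n₁) (16 * n₁) (-8 * n₁) a τ) ∧
        RationalWeight.eisInfty 2 (4 * n₁) (16 * n₁) (-8 * n₁) a τ =
          RationalWeight.etaPow (16 * n₁) (τ : ℂ) *
            RationalWeight.etaPow (-8 * n₁) (2 * (τ : ℂ))) ∧
    (∀ n₁ : ℚ, 2 / 3 < n₁ → n₁ ≤ 1 →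
      ∀ a : RationalWeight.EisIndex 3 → ℤ, RationalWeight.IsInverseChoice 3 a →
      ∀ τ : UpperHalfPlane,
        Summable (RationalWeight.eisTerm 3 (3 * n₁) (9 * n₁) (-3 * n₁) a τ) ∧
        RationalWeight.eisInfty 3 (3 * n₁) (9 * n₁) (-3 * n₁) a τ =
          RationalWeight.etaPow (9 * n₁) (τ : ℂ) *
            RationalWeight.etaPow (-3 * n₁) (3 * (τ : ℂ))) := by
  refine ⟨fun n₁ hlt hle a ha τ ↦ ?_, fun n₁ hlt hle a ha τ ↦ ?_⟩
  -- In both cases p r₁ + rₚ = 24n₁, so n₁ ≤ 1 is the bound on the vanishing order at 0, while the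
  -- lower bound on n₁ says that the weight exceeds 2.
  · have h0 : 16 * n₁ + (2 : ℕ) * (-8 * n₁) = 0 := by push_cast; ring
    have hk : 4 < 16 * n₁ + -8 * n₁ := by linarith
    have hn : (2 : ℕ) * (16 * n₁) + -8 * n₁ ≤ 24 := by push_cast; linarith
    rw [show 4 * n₁ = (16 * n₁ + -8 * n₁) / 2 by ring]
    refine ⟨RationalWeight.summable_eisTerm two_pos h0 hk ha τ, ?_⟩
    rw [RationalWeight.eisInfty_eq_etaQuot Nat.prime_two h0 hk hn ha, RationalWeight.etaQuot]
    norm_cast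
  · have h0 : 9 * n₁ + (3 : ℕ) * (-3 * n₁) = 0 := by push_cast; ring
    have hk : 4 < 9 * n₁ + -3 * n₁ := by linarith
    have hn : (3 : ℕ) * (9 * n₁) + -3 * n₁ ≤ 24 := by push_cast; linarith
    rw [show 3 * n₁ = (9 * n₁ + -3 * n₁) / 2 by ring]
    refine ⟨RationalWeight.summable_eisTerm three_pos h0 hk ha τ, ?_⟩
    rw [RationalWeight.eisInfty_eq_etaQuot Nat.prime_three h0 hk hn ha, RationalWeight.etaQuot]
    norm_cast
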